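/- For $\gamma=\begin{pmatrix}a&b\\c&d\end{pmatrix}\in\mathrm{SL}_2(\mathbb Z)$, $\tau$ in the upper half-plane $\mathcal H$, an integer $k\ge0$ and $f:\mathcal H\to\mathbb C$ put $$J(\gamma,\tau)=\Big(\frac cd\Big)\sqrt{c\tau+d},\qquad (f|_{k/2}\gamma)(\tau)=\frac{f(\gamma\tau)}{J(\gamma,\tau)^{k}},$$ where $(\frac cd)$ is the Kronecker symbol and $\sqrt z$ is the principal square root, with argument in $(-\frac\pi2,\frac\pi2]$ (so $J^{k}=(c\tau+d)^{k/2}$ for even $k$). Let $\Gamma(4)\subset\mathrm{SL}_2(\mathbb Z)$ be the principal congruence subgroup of level $4$. Let $\mathcal M(\Gamma(4))_{k/2}$ be the space of holomorphic functions $f$ on $\mathcal H$ such that $f|_{k/2}\gamma=f$ for all $\gamma\in\Gamma(4)$ and, for every $\alpha\in\mathrm{SL}_2(\mathbb Z)$, $(f|_{k/2}\alpha)(\tau)$ is bounded as $\operatorname{Im}\tau\to\infty$. Let $\mathcal S(\Gamma(4))_{k/2}\subset\mathcal M(\Gamma(4))_{k/2}$ be the subspace of those $f$ with $(f|_{k/2}\alpha)(\tau)\to0$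 as $\operatorname{Im}\tau\to\infty$ for every $\alpha\in\mathrm{SL}_2(\mathbb Z)$. Put $$\mathcal M(\Gamma(4))_{\frac12\mathbb N}=\bigoplus_{k\ge0}\mathcal M(\Gamma(4))_{k/2},\qquad \mathcal S(\Gamma(4))_{\frac12\mathbb N}=\bigoplus_{k\ge0}\mathcal S(\Gamma(4))_{k/2},$$ a graded $\mathbb C$-algebra and an ideal of it. With $q=e^{2\pi i\tau}$ put $$\theta(\tau)=\sum_{n\in\mathbb Z}q^{n^2},\quad \eta(\tau)=q^{1/24}\prod_{n\ge1}(1-q^n),\quad \eta^\flat(\tau)=\frac{\eta(\tau/2)^2}{\eta(\tau)},\quad \eta^\sharp(\tau)=\frac{\eta(2\tau)^2}{\eta(\tau)}.$$ Theorem. The functions $\theta(\tau/4)$, $\theta(\tau)$, $\eta^\flat(\tau/2)$ and $\eta^\sharp(2\tau)$ belong to $\mathcal M(\Gamma(4))_{1/2}$, the function $\eta^6$ belongs to $\mathcal M(\Gamma(4))_{3}$, and $$\mathcal M(\Gamma(4))_{\frac12\mathbb N}=\mathbb C\big[\theta(\tau/4),\theta(\tau)\big]=\mathbb C\big[\eta^\flat(\tau/2),\eta^\sharp(2\tau)\big],$$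 a polynomial ring in two variables: each of the two pairs generates the $\mathbb C$-algebra $\mathcal M(\Gamma(4))_{\frac12\mathbb N}$ and is algebraically independent over $\mathbb C$. Moreover the ideal of cusp forms is principal, generated by $\eta^6$: $$\mathcal S(\Gamma(4))_{\frac12\mathbb N}=\mathcal M(\Gamma(4))_{\frac12\mathbb N}\cdot\eta^6.$$ -/

import Mathlib

open scoped UpperHalfPlane MatrixGroups Manifold DirectSum

namespace HalfIntegralWeight

/-- The Kronecker symbol `(n | m)` for arbitrary integers `n`, `m`: the completely multiplicative
extension in `m` of the Legendre symbol with `(n | 2) = χ₈(n)`, with `(n | -1) = -1` if `n < 0`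
and `1` otherwise, and with `(n | 0) = 1` if `n = ±1` and `0` otherwise. -/
def kroneckerSymbol (n m : ℤ) : ℤ :=
  if m = 0 then (if n = 1 ∨ n = -1 then 1 else 0)
  else (if m < 0 ∧ n < 0 then -1 else 1) * ZMod.χ₈ (n : ZMod 8) ^ padicValNat 2 m.natAbs
    * jacobiSym n (m.natAbs / 2 ^ padicValNat 2 m.natAbs)

/-- The factor of weight `1/2`: `J(γ, τ) = (c | d) √(cτ + d)` for `γ = (a b; c d) ∈ SL₂(ℤ)`, with the
principal square root. The factor of weight `k/2` is its `k`-th power (see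
`halfFactor_pow_two_mul` and `halfFactor_pow_two_mul_add_one`). -/
noncomputable def halfFactor (γ : SL(2, ℤ)) (τ : ℍ) : ℂ :=
  (kroneckerSymbol (γ 1 0) (γ 1 1) : ℂ) * (((γ 1 0 : ℤ) : ℂ) * (τ : ℂ) + ((γ 1 1 : ℤ) : ℂ)) ^ (1 / 2 : ℂ)

/-- The operator `f ↦ f|_{k/2} γ` of weight `k/2`. -/
noncomputable def halfSlash (k : ℕ) (f : ℍ → ℂ) (γ : SL(2, ℤ)) : ℍ → ℂ :=
  fun τ => f (γ • τ) / halfFactor γ τ ^ k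

theorem kroneckerSymbol_sq {n m : ℤ} (h : IsCoprime n m) : kroneckerSymbol n m ^ 2 = 1 := by
  unfold kroneckerSymbol
  split_ifs with h0 h1 h2
  · norm_num
  · exfalso
    subst h0
    rw [isCoprime_zero_right, Int.isUnit_iff] at h
    exact h1 h
  all_goals
    have hodd : jacobiSym n (m.natAbs / 2 ^ padicValNat 2 m.natAbs) ^ 2 = 1 := by
      apply jacobiSym.sq_one
      have h3 : Nat.Coprime n.natAbs m.natAbs := Int.isCoprime_iff_gcd_eq_one.mp h
      exact Nat.Coprime.coprime_dvd_right (Nat.div_dvd_of_dvd pow_padicValNat_dvd) h3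
    have htwo : (ZMod.χ₈ (n : ZMod 8) ^ padicValNat 2 m.natAbs) ^ 2 = 1 := by
      by_cases hv : padicValNat 2 m.natAbs = 0
      · simp [hv]
      · have h2 : ¬ (2 : ℤ) ∣ n := by
          intro hd
          have hm : (2 : ℤ) ∣ m := by
            have := dvd_of_one_le_padicValNat (Nat.one_le_iff_ne_zero.mpr hv)
            omega
          have := h.isUnit_of_dvd' hd hm
          norm_num [Int.isUnit_iff] at this
        rw [← pow_mul, mul_comm, pow_mul]
        have : (ZMod.χ₈ (n : ZMod 8)) ^ 2 = 1 := by
          have hx : n % 8 = 1 ∨ n % 8 = 3 ∨ n % 8 = 5 ∨ n % 8 = 7 := by omega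
          rw [ZMod.χ₈_int_mod_eight]
          rcases hx with hx | hx | hx | hx <;> rw [hx] <;> decide
        rw [this, one_pow]
    simp only [mul_pow, hodd, htwo]
    norm_num

theorem isCoprime_lower_row (γ : SL(2, ℤ)) : IsCoprime (γ 1 0) (γ 1 1) := by
  have h := γ.det_coe
  rw [Matrix.det_fin_two] at h
  exact ⟨-γ 0 1, γ 0 0, by linarith⟩

theorem halfFactor_sq (γ : SL(2, ℤ)) (τ : ℍ) :
    halfFactor γ τ ^ 2 = ((γ 1 0 : ℤ) : ℂ) * (τ : ℂ) + ((γ 1 1 : ℤ) : ℂ) := by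
  have h : (kroneckerSymbol (γ 1 0) (γ 1 1) : ℂ) ^ 2 = 1 := by
    exact_mod_cast kroneckerSymbol_sq (isCoprime_lower_row γ)
  rw [halfFactor, mul_pow, h, one_mul, ← Complex.cpow_nat_mul]
  norm_num

/-- In integral weight `m` one gets the usual factor `(cτ + d) ^ m`. -/
theorem halfFactor_pow_two_mul (γ : SL(2, ℤ)) (τ : ℍ) (m : ℕ) :
    halfFactor γ τ ^ (2 * m) = (((γ 1 0 : ℤ) : ℂ) * (τ : ℂ) + ((γ 1 1 : ℤ) : ℂ)) ^ m := by
  rw [pow_mul, halfFactor_sq]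

/-- In weight `k/2` with `k` odd one gets the factor `(c | d) √(cτ + d) ^ k`. -/
theorem halfFactor_pow_two_mul_add_one (γ : SL(2, ℤ)) (τ : ℍ) (m : ℕ) :
    halfFactor γ τ ^ (2 * m + 1) = (kroneckerSymbol (γ 1 0) (γ 1 1) : ℂ) *
      ((((γ 1 0 : ℤ) : ℂ) * (τ : ℂ) + ((γ 1 1 : ℤ) : ℂ)) ^ (1 / 2 : ℂ)) ^ (2 * m + 1) := by
  have h : (kroneckerSymbol (γ 1 0) (γ 1 1) : ℂ) ^ 2 = 1 := by
    exact_mod_cast kroneckerSymbol_sq (isCoprime_lower_row γ)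
  rw [halfFactor, mul_pow, pow_succ (kroneckerSymbol _ _ : ℂ), pow_mul (kroneckerSymbol _ _ : ℂ), h,
    one_pow, one_mul]

theorem halfSlash_zero (k : ℕ) (γ : SL(2, ℤ)) : halfSlash k 0 γ = 0 := by
  ext τ; simp [halfSlash]

theorem halfSlash_add (k : ℕ) (f g : ℍ → ℂ) (γ : SL(2, ℤ)) :
    halfSlash k (f + g) γ = halfSlash k f γ + halfSlash k g γ := by
  ext τ; simp [halfSlash, add_div]

theorem halfSlash_smul (k : ℕ) (a : ℂ) (f : ℍ → ℂ) (γ : SL(2, ℤ)) :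
    halfSlash k (a • f) γ = a • halfSlash k f γ := by
  ext τ; simp [halfSlash, mul_div_assoc]

theorem halfSlash_mul (j k : ℕ) (f g : ℍ → ℂ) (γ : SL(2, ℤ)) :
    halfSlash (j + k) (f * g) γ = halfSlash j f γ * halfSlash k g γ := by
  ext τ; simp [halfSlash, pow_add, mul_div_mul_comm]

theorem halfSlash_one (γ : SL(2, ℤ)) : halfSlash 0 1 γ = 1 := by
  ext τ; simp [halfSlash]

/-- `M(Γ)_{k/2}`: the space of modular forms of weight `k/2` for `Γ`. -/
noncomputable def modForms (Γ : Subgroup SL(2, ℤ)) (k : ℕ) : Submodule ℂ (ℍ → ℂ) where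
  carrier := {f | MDifferentiable 𝓘(ℂ) 𝓘(ℂ) f ∧ (∀ γ ∈ Γ, halfSlash k f γ = f) ∧
    ∀ α : SL(2, ℤ), UpperHalfPlane.IsBoundedAtImInfty (halfSlash k f α)}
  zero_mem' := by
    refine ⟨mdifferentiable_const, fun γ _ => halfSlash_zero k γ, fun α => ?_⟩
    rw [halfSlash_zero]
    exact UpperHalfPlane.zero_form_isBoundedAtImInfty
  add_mem' := by
    rintro f g ⟨hf, hf', hf''⟩ ⟨hg, hg', hg''⟩
    refine ⟨hf.add hg, fun γ h => by rw [halfSlash_add, hf' γ h, hg' γ h], fun α => ?_⟩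
    rw [halfSlash_add]
    exact (UpperHalfPlane.boundedAtImInftySubalgebra ℂ).add_mem (hf'' α) (hg'' α)
  smul_mem' := by
    rintro a f ⟨hf, hf', hf''⟩
    refine ⟨hf.const_smul a, fun γ h => by rw [halfSlash_smul, hf' γ h], fun α => ?_⟩
    rw [halfSlash_smul]
    exact (UpperHalfPlane.boundedAtImInftySubalgebra ℂ).smul_mem (hf'' α) a

/-- `S(Γ)_{k/2}`: the space of cusp forms of weight `k/2` for `Γ`. -/
noncomputable def cuspForms (Γ : Subgroup SL(2, ℤ)) (k : ℕ) : Submodule ℂ (ℍ → ℂ) where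
  carrier := {f | MDifferentiable 𝓘(ℂ) 𝓘(ℂ) f ∧ (∀ γ ∈ Γ, halfSlash k f γ = f) ∧
    ∀ α : SL(2, ℤ), UpperHalfPlane.IsZeroAtImInfty (halfSlash k f α)}
  zero_mem' := by
    refine ⟨mdifferentiable_const, fun γ _ => halfSlash_zero k γ, fun α => ?_⟩
    rw [halfSlash_zero]
    exact (UpperHalfPlane.zeroAtImInftySubmodule ℂ).zero_mem
  add_mem' := by
    rintro f g ⟨hf, hf', hf''⟩ ⟨hg, hg', hg''⟩
    refine ⟨hf.add hg, fun γ h => by rw [halfSlash_add, hf' γ h, hg' γ h], fun α => ?_⟩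
    rw [halfSlash_add]
    exact (UpperHalfPlane.zeroAtImInftySubmodule ℂ).add_mem (hf'' α) (hg'' α)
  smul_mem' := by
    rintro a f ⟨hf, hf', hf''⟩
    refine ⟨hf.const_smul a, fun γ h => by rw [halfSlash_smul, hf' γ h], fun α => ?_⟩
    rw [halfSlash_smul]
    exact (UpperHalfPlane.zeroAtImInftySubmodule ℂ).smul_mem a (hf'' α)

/-- Products of forms of weights `j/2` and `k/2` have weight `(j + k)/2`, so `⨁ k, modForms Γ k`
is a commutative graded `ℂ`-algebra. -/
instance modForms_gradedMonoid (Γ : Subgroup SL(2, ℤ)) : SetLike.GradedMonoid (modForms Γ) where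
  one_mem := by
    refine ⟨mdifferentiable_const, fun γ _ => halfSlash_one γ, fun α => ?_⟩
    rw [halfSlash_one]
    exact (UpperHalfPlane.boundedAtImInftySubalgebra ℂ).one_mem
  mul_mem := by
    rintro j k f g ⟨hf, hf', hf''⟩ ⟨hg, hg', hg''⟩
    refine ⟨hf.mul hg, fun γ h => by rw [halfSlash_mul, hf' γ h, hg' γ h], fun α => ?_⟩
    rw [halfSlash_mul]
    exact (UpperHalfPlane.boundedAtImInftySubalgebra ℂ).mul_mem (hf'' α) (hg'' α)

/-- `M(Γ)_{½ℕ} = ⨁_{k ≥ 0} M(Γ)_{k/2}`, the graded ring of modular forms of half-integral weight;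
the component with index `k` consists of the forms of weight `k/2`. -/
abbrev ModRing (Γ : Subgroup SL(2, ℤ)) : Type := ⨁ k : ℕ, modForms Γ k

theorem mul_mem_cuspForms {Γ : Subgroup SL(2, ℤ)} {j k : ℕ} {f g : ℍ → ℂ}
    (hf : f ∈ modForms Γ j) (hg : g ∈ cuspForms Γ k) : f * g ∈ cuspForms Γ (j + k) := by
  obtain ⟨hf, hf', hf''⟩ := hf
  obtain ⟨hg, hg', hg''⟩ := hg
  refine ⟨hf.mul hg, fun γ h => by rw [halfSlash_mul, hf' γ h, hg' γ h], fun α => ?_⟩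
  rw [halfSlash_mul]
  exact Filter.BoundedAtFilter.mul_zeroAtFilter (hf'' α) (hg'' α)

/-- `S(Γ)_{½ℕ} = ⨁_{k ≥ 0} S(Γ)_{k/2}` as an ideal of `M(Γ)_{½ℕ}`: the elements all of whose
components are cusp forms. -/
noncomputable def cuspIdeal (Γ : Subgroup SL(2, ℤ)) : Ideal (ModRing Γ) where
  carrier := {F | ∀ k, (F k : ℍ → ℂ) ∈ cuspForms Γ k}
  zero_mem' := fun k => by simp
  add_mem' := fun {F G} hF hG k => by
    simpa using (cuspForms Γ k).add_mem (hF k) (hG k)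
  smul_mem' := fun F G hG k => by
    classical
    rw [smul_eq_mul, DirectSum.coe_mul_apply]
    refine Submodule.sum_mem _ fun ij hij => ?_
    rw [← (Finset.mem_filter.mp hij).2]
    exact mul_mem_cuspForms (F ij.1).2 (hG ij.2)

/-- `θ(τ) = ∑_{n ∈ ℤ} q^{n²}` with `q = e^{2πiτ}`. -/
noncomputable def theta (τ : ℂ) : ℂ :=
  ∑' n : ℤ, Complex.exp (2 * Real.pi * Complex.I * (n : ℂ) ^ 2 * τ)

/-- `η^♭(τ) = η(τ/2)² / η(τ)`, with `η` the Dedekind eta function. -/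
noncomputable def etaFlat (τ : ℂ) : ℂ := ModularForm.eta (τ / 2) ^ 2 / ModularForm.eta τ

/-- `η^♯(τ) = η(2τ)² / η(τ)`, with `η` the Dedekind eta function. -/
noncomputable def etaSharp (τ : ℂ) : ℂ := ModularForm.eta (2 * τ) ^ 2 / ModularForm.eta τ

/-- A modular form of weight `k/2` as a homogeneous element of the graded ring. -/
noncomputable def ModRing.form {Γ : Subgroup SL(2, ℤ)} {k : ℕ} {f : ℍ → ℂ}
    (hf : f ∈ modForms Γ k) : ModRing Γ :=
  DirectSum.of (fun k : ℕ => modForms Γ k) k ⟨f, hf⟩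

end HalfIntegralWeight

open HalfIntegralWeight CongruenceSubgroup

/-! ### Periodicity of the Kronecker symbol. -/

namespace HalfIntegralWeight

/-! Write E = θ(τ) (`thetaEven`) and O = θ(τ/4) - θ(τ) (`thetaOdd`), the parts of the series θ(τ/4)
with even and odd summation index. The functional equation of θ under τ ↦ -1/(4τ) and periodicity
give its multiplier on Γ₁(4) (`theta_smul`), and conjugation by a diagonal matrix treats θ(τ/4). The
span of E and O is stable under all of SL₂(ℤ): T acts by diag(1, i), S by a multiple of (1 1; 1 -1),
so boundedness at every cusp follows from boundedness at i∞.

The pivot is `exists_thetaProd_eq`: E·O·(E⁴ - O⁴) = c·η⁶ with c ≠ 0. Both sides pick up the same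
factors under S and T, so their quotient is invariant under SL₂(ℤ), bounded at i∞, hence constant.
Since η has no zeros on ℍ, neither do E, O and E - aO with a⁴ = 1. Moreover O vanishes at the cusp
i∞ only, to first order in e^{2πiτ/4} (`div_thetaOdd_mem_modForms`).

Generation follows by induction on the weight: subtracting a multiple of a power of E makes a form
vanish at i∞, dividing by O lowers the weight by 1/2, and forms of weight 0 are constant.
Independence holds because the quotient of the two generators takes infinitely many values
(`algebraicIndependent_form_pair`).

At every cusp η⁶ has exactly the decay e^{-πy/2}, the slowest that a cusp form can have. Cusp forms
of weight at least 3 are thus divisible by η⁶, and below weight 3 there are none except 0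
(`cuspIdeal_eq_span`).

For the eta quotients, η^♯(2τ)/O is invariant under Γ(4) and bounded at all cusps, hence constant;
applying S shows that η^♭(τ/2) is a multiple of E - O (`exists_etaQuot_eq`). The two pairs therefore
span the same plane. -/

theorem kroneckerSymbol_of_odd (n : ℤ) {m : ℤ} (hm : Odd m) :
    kroneckerSymbol n m = (if m < 0 ∧ n < 0 then -1 else 1) * jacobiSym n m.natAbs := by
  have h0 : m ≠ 0 := by rintro rfl; simp at hm
  have h2 : padicValNat 2 m.natAbs = 0 := by
    apply padicValNat.eq_zero_of_not_dvd
    rw [← even_iff_two_dvd, Int.natAbs_even]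
    exact Int.not_even_iff_odd.mpr hm
  simp [kroneckerSymbol, h0, h2]

/-- With n = 4c, the factor 4 is invisible to odd lower entries, and quadratic reciprocity makes (c
| ·) periodic modulo 4|c| = |n|. -/
theorem jacobiSym_congr_right {n : ℤ} {a b : ℕ} (ha : Odd a) (hb : Odd b) (h4 : 4 ∣ n)
    (h : a ≡ b [MOD n.natAbs]) : jacobiSym n a = jacobiSym n b := by
  obtain ⟨c, rfl⟩ := h4
  rw [jacobiSym.mul_left, jacobiSym.mul_left, jacobiSym.at_four ha, jacobiSym.at_four hb,
    jacobiSym.mod_right c ha, jacobiSym.mod_right c hb]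
  rw [Int.natAbs_mul] at h
  rw [show a % (4 * c.natAbs) = b % (4 * c.natAbs) from h]

/-- Here |n| ≡ 1 mod a, so only the sign of n matters, and it enters through (-1 | a) = -1 because a
≡ 3 mod 4. -/
theorem jacobiSym_of_add_one_eq {n : ℤ} {a : ℕ} (h4 : 4 ∣ n)
    (h : a + 1 = n.natAbs) : jacobiSym n a = if n < 0 then -1 else 1 := by
  have hodd : Odd a := by rw [Nat.odd_iff]; omega
  have h1 : jacobiSym n.natAbs a = 1 := by
    rw [← jacobiSym.one_left a]
    apply jacobiSym.mod_left'
    rw [← h]; push_cast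
    simp
  split_ifs with hn
  · rw [show n = -(n.natAbs : ℤ) by omega, jacobiSym.neg _ hodd, h1, ZMod.χ₄_nat_three_mod_four (by omega)]
    norm_num
  · rwa [show n = (n.natAbs : ℤ) by omega]

/-- The class of -1 modulo |n| is represented by |n| - 1, whose symbol is the sign of n. From b ≡ -a
one gets ab ≡ (|n| - 1)a², and multiplicativity in the lower entry does the rest. -/
theorem jacobiSym_of_dvd_add {n : ℤ} {a b : ℕ} (ha : Odd a) (hb : Odd b) (h4 : 4 ∣ n)
    (h0 : n ≠ 0) (hcop : IsCoprime n a) (h : n.natAbs ∣ a + b) :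
    jacobiSym n b = (if n < 0 then -1 else 1) * jacobiSym n a := by
  have ha0 : a ≠ 0 := by rintro rfl; simp at ha
  have hb0 : b ≠ 0 := by rintro rfl; simp at hb
  have h4' : 4 ≤ n.natAbs := by omega
  have ha1 : n.natAbs - 1 ≠ 0 := by omega
  have h5 : jacobiSym n (a * b) = jacobiSym n ((n.natAbs - 1) * (a * a)) := by
    apply jacobiSym_congr_right (ha.mul hb) _ h4
    · rw [← Int.natCast_modEq_iff]
      refine (Int.modEq_iff_dvd.mpr ?_)
      obtain ⟨k, hk⟩ := h
      refine ⟨a * a - a * k, ?_⟩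
      have hk' : (a : ℤ) + b = n.natAbs * k := by exact_mod_cast hk
      have hb' : (b : ℤ) = n.natAbs * k - a := by linarith
      push_cast [Nat.cast_sub (show 1 ≤ n.natAbs by omega)]
      push_cast at hb'
      rw [hb']; ring
    · refine Odd.mul ?_ (ha.mul ha)
      rw [Nat.odd_iff]; omega
  have hsq : jacobiSym n a * jacobiSym n a = 1 := by
    rw [← sq]
    exact jacobiSym.sq_one (Int.isCoprime_iff_gcd_eq_one.mp hcop)
  rw [jacobiSym.mul_right' _ ha0 hb0, jacobiSym.mul_right' _ ha1 (mul_ne_zero ha0 ha0),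
    jacobiSym.mul_right' _ ha0 ha0, hsq, mul_one,
    jacobiSym_of_add_one_eq (a := n.natAbs - 1) h4 (by omega)] at h5
  calc jacobiSym n b = jacobiSym n a * (jacobiSym n a * jacobiSym n b) := by
        rw [← mul_assoc, hsq, one_mul]
    _ = _ := by rw [h5, mul_comm]

/-- `(n | ·)` is periodic modulo `n` on odd integers when `4 ∣ n`. -/
theorem kroneckerSymbol_add_right {n m : ℤ} (h4 : 4 ∣ n) (hm : Odd m) (hcop : IsCoprime n m) :
    kroneckerSymbol n (m + n) = kroneckerSymbol n m := by
  rcases eq_or_ne n 0 with rfl | h0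
  · simp
  have hn : Even n := (even_iff_two_dvd).mpr (Dvd.dvd.trans (by norm_num) h4)
  have hmn : Odd (m + n) := hm.add_even hn
  have ha : Odd m.natAbs := Int.natAbs_odd.mpr hm
  have hb : Odd (m + n).natAbs := Int.natAbs_odd.mpr hmn
  have hcop' : IsCoprime n (m.natAbs : ℤ) := by
    rcases Int.natAbs_eq m with h | h
    · rwa [← h]
    · rw [h] at hcop; exact (IsCoprime.neg_right_iff _ _).mp hcop
  have hm0 : m ≠ 0 := by rintro rfl; simp at hm
  have hmn0 : m + n ≠ 0 := by intro h; rw [h] at hmn; simp at hmn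
  rw [kroneckerSymbol_of_odd _ hm, kroneckerSymbol_of_odd _ hmn]
  by_cases hs : (m < 0 ↔ m + n < 0)
  · simp only [hs]
    congr 1
    apply jacobiSym_congr_right hb ha h4
    rw [← Int.natCast_modEq_iff, Int.modEq_iff_dvd, Int.natCast_natAbs, abs_dvd]
    by_cases hm1 : m < 0
    · refine ⟨1, ?_⟩; omega
    · refine ⟨-1, ?_⟩; omega
  -- If m and m + n have opposite signs, then |m| + |m + n| = |n|. The sign of n produced by this
  -- reflection cancels the sign that the Kronecker symbol attaches to two negative entries.
  · rw [jacobiSym_of_dvd_add ha hb h4 h0 hcop', ← mul_assoc]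
    · congr 1
      split_ifs <;> first | rfl | omega
    · have : m.natAbs + (m + n).natAbs = n.natAbs := by omega
      rw [this]

theorem jacobiSym_add_mul_left (n k m : ℤ) :
    jacobiSym (n + k * m) m.natAbs = jacobiSym n m.natAbs := by
  apply jacobiSym.mod_left'
  rw [Int.natCast_natAbs, Int.emod_abs, Int.emod_abs, Int.add_mul_emod_self_right]

theorem kroneckerSymbol_add_mul_left {n m : ℤ} (hm : Odd m)
    (hs : m < 0 → (n + 4 * m < 0 ↔ n < 0)) :
    kroneckerSymbol (n + 4 * m) m = kroneckerSymbol n m := by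
  rw [kroneckerSymbol_of_odd _ hm, kroneckerSymbol_of_odd _ hm, jacobiSym_add_mul_left]
  congr 1
  split_ifs <;> first | rfl | omega

/-- This exceptional sign compensates the branch jump of the square root in
`halfFactor_mul_lowerFour`. -/
theorem kroneckerSymbol_add_mul_left_of_neg {n m : ℤ} (hm : Odd m) (h : m < 0) (h1 : 0 ≤ n)
    (h2 : n + 4 * m < 0) :
    kroneckerSymbol (n + 4 * m) m = -kroneckerSymbol n m := by
  rw [kroneckerSymbol_of_odd _ hm, kroneckerSymbol_of_odd _ hm, jacobiSym_add_mul_left,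
    if_pos ⟨h, h2⟩, if_neg (by omega)]
  ring

end HalfIntegralWeight

/-! ### Generators of Γ₁(4). -/

namespace HalfIntegralWeight

open ModularGroup

/-- The matrix `(1 0; 4 1)`, which generates `Γ₁(4)` together with `T`. -/
def lowerFour : SL(2, ℤ) := ⟨!![1, 0; 4, 1], by simp⟩

theorem coe_lowerFour : (lowerFour : Matrix (Fin 2) (Fin 2) ℤ) = !![1, 0; 4, 1] := rfl

theorem mul_T_zpow_lower_left (γ : SL(2, ℤ)) (n : ℤ) : (γ * T ^ n) 1 0 = γ 1 0 := by
  simp [Matrix.SpecialLinearGroup.coe_mul, coe_T_zpow, Matrix.mul_apply]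

theorem mul_T_zpow_lower_right (γ : SL(2, ℤ)) (n : ℤ) :
    (γ * T ^ n) 1 1 = n * γ 1 0 + γ 1 1 := by
  simp [Matrix.SpecialLinearGroup.coe_mul, coe_T_zpow, Matrix.mul_apply, mul_comm]

theorem mul_T_lower_left (γ : SL(2, ℤ)) : (γ * T) 1 0 = γ 1 0 := by
  simpa using mul_T_zpow_lower_left γ 1

theorem mul_T_lower_right (γ : SL(2, ℤ)) : (γ * T) 1 1 = γ 1 1 + γ 1 0 := by
  simpa [add_comm] using mul_T_zpow_lower_right γ 1

theorem mul_lowerFour_lower_left (γ : SL(2, ℤ)) :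
    (γ * lowerFour) 1 0 = γ 1 0 + 4 * γ 1 1 := by
  simp [coe_lowerFour, Matrix.SpecialLinearGroup.coe_mul, Matrix.mul_apply, mul_comm]

theorem mul_lowerFour_lower_right (γ : SL(2, ℤ)) : (γ * lowerFour) 1 1 = γ 1 1 := by
  simp [coe_lowerFour, Matrix.SpecialLinearGroup.coe_mul, Matrix.mul_apply]

theorem eq_T_zpow_of_lower_row {γ : SL(2, ℤ)} (hc : γ 1 0 = 0) (hd : γ 1 1 = 1) :
    γ = T ^ (γ 0 1) := by
  have h := γ.det_coe
  rw [Matrix.det_fin_two, hc, hd] at h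
  ext i j
  rw [coe_T_zpow]
  fin_cases i <;> fin_cases j <;> simp <;> linarith

/-- `Γ₁(4)` is generated by `T` and `(1 0; 4 1)`, as an induction principle. -/
theorem gammaOneFour_induction {p : SL(2, ℤ) → Prop} (one : p 1)
    (mul_T : ∀ γ : SL(2, ℤ), 4 ∣ γ 1 0 → γ 1 1 % 4 = 1 → (p (γ * T) ↔ p γ))
    (mul_U : ∀ γ : SL(2, ℤ), 4 ∣ γ 1 0 → γ 1 1 % 4 = 1 → (p (γ * lowerFour) ↔ p γ))
    (γ : SL(2, ℤ)) (hc : 4 ∣ γ 1 0) (hd : γ 1 1 % 4 = 1) : p γ := by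
  -- The hypotheses are equivalences, so they carry over to the inverses of both generators.
  have mul_T' : ∀ γ : SL(2, ℤ), 4 ∣ γ 1 0 → γ 1 1 % 4 = 1 → (p (γ * T⁻¹) ↔ p γ) := by
    intro γ hc hd
    have h1 := mul_T_zpow_lower_left γ (-1)
    have h2 := mul_T_zpow_lower_right γ (-1)
    rw [zpow_neg_one] at h1 h2
    rw [← mul_T (γ * T⁻¹) (by rwa [h1]) (by omega), inv_mul_cancel_right]
  have hU : ∀ γ : SL(2, ℤ), (γ * lowerFour⁻¹) 1 0 = γ 1 0 - 4 * γ 1 1 ∧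
      (γ * lowerFour⁻¹) 1 1 = γ 1 1 := by
    intro γ
    have h1 := mul_lowerFour_lower_left (γ * lowerFour⁻¹)
    have h2 := mul_lowerFour_lower_right (γ * lowerFour⁻¹)
    rw [inv_mul_cancel_right] at h1 h2
    omega
  have mul_U' : ∀ γ : SL(2, ℤ), 4 ∣ γ 1 0 → γ 1 1 % 4 = 1 → (p (γ * lowerFour⁻¹) ↔ p γ) := by
    intro γ hc hd
    obtain ⟨h1, h2⟩ := hU γ
    rw [← mul_U (γ * lowerFour⁻¹) (by omega) (by omega), inv_mul_cancel_right]
  induction hN : (γ 1 0).natAbs + (γ 1 1).natAbs using Nat.strong_induction_on generalizing γ with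
  | _ N ih =>
  rcases eq_or_ne (γ 1 0) 0 with h0 | h0
  · have hu := isCoprime_lower_row γ
    rw [h0, isCoprime_zero_left, Int.isUnit_iff] at hu
    have h1 : γ 1 1 = 1 := by omega
    have hT : ∀ n : ℕ, p (T ^ (n : ℤ)) ∧ p (T ^ (-n : ℤ)) := by
      intro n
      induction n with
      | zero => simpa using one
      | succ n ihn =>
        have h2 : ∀ n : ℤ, 4 ∣ (T ^ n) 1 0 ∧ (T ^ n) 1 1 % 4 = 1 := by
          intro n; rw [coe_T_zpow]; simp
        push_cast
        rw [neg_add, zpow_add, zpow_one, zpow_add, zpow_neg_one, mul_T _ (h2 _).1 (h2 _).2,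
          mul_T' _ (h2 _).1 (h2 _).2]
        exact ihn
    rw [eq_T_zpow_of_lower_row h0 h1]
    obtain ⟨n, hn | hn⟩ := (γ 0 1).eq_nat_or_neg <;> rw [hn]
    · exact (hT n).1
    · exact (hT n).2
  have hT1 := mul_T_lower_left γ
  have hT2 := mul_T_lower_right γ
  have hT3 := mul_T_zpow_lower_left γ (-1)
  have hT4 := mul_T_zpow_lower_right γ (-1)
  rw [zpow_neg_one] at hT3 hT4
  have hU1 := mul_lowerFour_lower_left γ
  have hU2 := mul_lowerFour_lower_right γ
  obtain ⟨hU3, hU4⟩ := hU γ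
  -- Descent on |c| + |d|. If 2|d| < |c|, one of c ± 4d is smaller than c in absolute value.
  -- Otherwise |c| < 2|d|, equality being excluded by 4 ∣ c and d odd, and one of d ± c is smaller
  -- than d.
  by_cases hle : 2 * (γ 1 1).natAbs < (γ 1 0).natAbs
  · by_cases hs : 0 < γ 1 0 ↔ 0 < γ 1 1
    · rw [← mul_U' γ hc hd]
      exact ih _ (by omega) _ (by omega) (by omega) rfl
    · rw [← mul_U γ hc hd]
      exact ih _ (by omega) _ (by omega) (by omega) rfl
  · by_cases hs : 0 < γ 1 0 ↔ 0 < γ 1 1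
    · rw [← mul_T' γ hc hd]
      exact ih _ (by omega) _ (by omega) (by omega) rfl
    · rw [← mul_T γ hc hd]
      exact ih _ (by omega) _ (by omega) (by omega) rfl

/-! ### The automorphy factor on `Γ₁(4)` -/

theorem sqrt_ne_zero {z : ℂ} (hz : z ≠ 0) : z ^ (1 / 2 : ℂ) ≠ 0 := by
  simp [Complex.cpow_eq_zero_iff, hz]

theorem sqrt_sq (z : ℂ) : (z ^ (1 / 2 : ℂ)) ^ 2 = z := by
  rw [← Complex.cpow_nat_mul]; norm_num

theorem eq_sqrt_of_sq {w z : ℂ} (h : w ^ 2 = z) (hw : 0 < w.re) : w = z ^ (1 / 2 : ℂ) := by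
  rw [← h, one_div, Complex.sq_cpow_two_inv hw]

theorem sqrt_re_pos {z : ℂ} (hz : z ∈ Complex.slitPlane) : 0 < (z ^ (1 / 2 : ℂ)).re := by
  have h0 := Complex.slitPlane_ne_zero hz
  have h1 := (Complex.mem_slitPlane_iff_arg.mp hz).1
  rw [Complex.cpow_def_of_ne_zero h0, Complex.exp_re]
  apply mul_pos (Real.exp_pos _)
  apply Real.cos_pos_of_mem_Ioo
  have h2 : (Complex.log z * (1 / 2)).im = z.arg / 2 := by
    rw [show (1 / 2 : ℂ) = ((1 / 2 : ℝ) : ℂ) by norm_num, Complex.im_mul_ofReal, Complex.log_im]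
    ring
  rw [h2]
  have h3 := Complex.neg_pi_lt_arg z
  have h4 := lt_of_le_of_ne (Complex.arg_le_pi z) h1
  constructor <;> linarith

theorem sqrt_im_pos {z : ℂ} (hz : 0 < z.im) : 0 < (z ^ (1 / 2 : ℂ)).im := by
  have h1 := sqrt_re_pos (z := z) (Or.inr hz.ne')
  have h2 := congrArg Complex.im (sqrt_sq z)
  rw [sq, Complex.mul_im] at h2
  by_contra! h
  nlinarith

theorem sqrt_im_neg {z : ℂ} (hz : z.im < 0) : (z ^ (1 / 2 : ℂ)).im < 0 := by
  have h1 := sqrt_re_pos (z := z) (Or.inr hz.ne)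
  have h2 := congrArg Complex.im (sqrt_sq z)
  rw [sq, Complex.mul_im] at h2
  by_contra! h
  nlinarith

/-! ### Transformation of θ under the generators. -/

theorem theta_eq_jacobiTheta (τ : ℂ) : theta τ = jacobiTheta (2 * τ) := by
  refine tsum_congr fun n => ?_
  congr 1; ring

theorem theta_add_one (τ : ℂ) : theta (τ + 1) = theta τ := by
  rw [theta_eq_jacobiTheta, theta_eq_jacobiTheta, mul_add, mul_one, add_comm, jacobiTheta_two_add]

theorem theta_neg_inv {τ : ℂ} (hτ : 0 < τ.im) :
    theta (-1 / (4 * τ)) = (-2 * Complex.I * τ) ^ (1 / 2 : ℂ) * theta τ := by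
  have h := jacobiTheta_S_smul ⟨2 * τ, by simpa using hτ⟩
  rw [UpperHalfPlane.modular_S_smul] at h
  have h0 : τ ≠ 0 := by rintro rfl; simp at hτ
  rw [theta_eq_jacobiTheta, theta_eq_jacobiTheta]
  convert h using 2
  · field_simp; norm_num
  · congr 1; ring

theorem coe_lowerFour_smul (τ : ℍ) : ((lowerFour • τ : ℍ) : ℂ) = τ / (4 * τ + 1) := by
  rw [UpperHalfPlane.specialLinearGroup_apply]
  simp [coe_lowerFour]

/-- The involution τ ↦ -1/(4τ) conjugates (1 0; 4 1) into a unit translation, so the inversion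
formula is used twice, at τ and at w = -1/(4τ) - 1. -/
theorem theta_lowerFour_smul (τ : ℍ) :
    theta ((lowerFour • τ : ℍ) : ℂ) = (4 * (τ : ℂ) + 1) ^ (1 / 2 : ℂ) * theta τ := by
  have h0 := UpperHalfPlane.ne_zero τ
  have h1 : (4 * (τ : ℂ) + 1) ≠ 0 := by
    intro h
    have := congrArg Complex.im h
    simp at this
    exact τ.im_ne_zero this
  set w : ℂ := -1 / (4 * (τ : ℂ)) + -1 with hw
  have hwim : 0 < (-1 / (4 * (τ : ℂ))).im := by
    rw [Complex.div_im]
    have h1 := τ.im_pos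
    have h2 := Complex.normSq_pos.mpr (mul_ne_zero (by norm_num : (4 : ℂ) ≠ 0) h0)
    simp only [Complex.neg_im, Complex.one_im, neg_zero, zero_mul, zero_div, Complex.neg_re,
      Complex.one_re, zero_sub, neg_mul, one_mul, neg_div, neg_neg]
    exact div_pos (by simpa using h1) h2
  have hwim' : 0 < w.im := by rw [hw]; simpa using hwim
  have e1 : ((lowerFour • τ : ℍ) : ℂ) = -1 / (4 * w) := by
    have h2 : -1 - 4 * (τ : ℂ) ≠ 0 := by
      intro h; apply h1; linear_combination -h
    rw [coe_lowerFour_smul, hw]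
    have : 4 * (-1 / (4 * (τ : ℂ)) + -1) = -((4 * (τ : ℂ) + 1) / τ) := by field_simp; ring
    rw [this]
    field_simp
  have e2 : theta w = theta (-1 / (4 * (τ : ℂ))) := by
    rw [← theta_add_one w, hw, neg_add_cancel_right]
  rw [e1, theta_neg_inv hwim', e2, theta_neg_inv τ.im_pos, ← mul_assoc]
  congr 1
  -- Each root has argument strictly between -π/4 and π/4, so the product of the two lies in the
  -- right half-plane and is the principal root.
  have key : ∀ z : ℂ, 0 < z.im → 0 < ((-2 * Complex.I * z) ^ (1 / 2 : ℂ)).re ∧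
      |((-2 * Complex.I * z) ^ (1 / 2 : ℂ)).im| < ((-2 * Complex.I * z) ^ (1 / 2 : ℂ)).re := by
    intro z hz
    have hre : 0 < (-2 * Complex.I * z).re := by simp; linarith
    have h1 := sqrt_re_pos (z := -2 * Complex.I * z) (Or.inl hre)
    have h2 := congrArg Complex.re (sqrt_sq (-2 * Complex.I * z))
    rw [sq, Complex.mul_re] at h2
    refine ⟨h1, abs_lt_of_sq_lt_sq ?_ h1.le⟩
    nlinarith
  apply eq_sqrt_of_sq
  · rw [mul_pow, sqrt_sq, sqrt_sq, hw]
    field_simp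
    rw [Complex.I_sq]; ring
  · obtain ⟨a1, a2⟩ := key w hwim'
    obtain ⟨b1, b2⟩ := key τ τ.im_pos
    rw [Complex.mul_re, sub_pos]
    calc _ ≤ |_| := le_abs_self _
      _ = _ := abs_mul _ _
      _ < _ := mul_lt_mul'' a2 b2 (abs_nonneg _) (abs_nonneg _)

/-! ### The theta multiplier. -/

theorem halfFactor_mul_T {γ : SL(2, ℤ)} (hc : 4 ∣ γ 1 0) (hd : γ 1 1 % 4 = 1) (τ : ℍ) :
    halfFactor (γ * T) τ = halfFactor γ (T • τ) := by
  rw [halfFactor, halfFactor, mul_T_lower_left, mul_T_lower_right,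
    kroneckerSymbol_add_right hc (by rw [Int.odd_iff]; omega) (isCoprime_lower_row γ),
    UpperHalfPlane.modular_T_smul, UpperHalfPlane.coe_vadd]
  congr 2
  push_cast; ring

/-- The product of the two principal roots is the principal root of the product except when c > 0 >
c + 4d, where it is the negative. This is precisely where the Kronecker symbol changes sign. -/
theorem halfFactor_mul_lowerFour {γ : SL(2, ℤ)} (hc : 4 ∣ γ 1 0) (hd : γ 1 1 % 4 = 1) (τ : ℍ) :
    halfFactor (γ * lowerFour) τ =
      halfFactor γ (lowerFour • τ) * (4 * (τ : ℂ) + 1) ^ (1 / 2 : ℂ) := by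
  have hodd : Odd (γ 1 1) := by rw [Int.odd_iff]; omega
  have hB0 : 4 * (τ : ℂ) + 1 ≠ 0 := by
    intro h
    have := congrArg Complex.im h
    simp at this
    exact τ.im_ne_zero this
  have hw : ((lowerFour • τ : ℍ) : ℂ) * (4 * (τ : ℂ) + 1) = τ := by
    rw [coe_lowerFour_smul, div_mul_cancel₀ _ hB0]
  rw [halfFactor, halfFactor, mul_lowerFour_lower_left, mul_lowerFour_lower_right]
  have hcop := isCoprime_lower_row γ
  have hcd : γ 1 0 = 0 → γ 1 1 = 1 := by
    intro h
    rw [h, isCoprime_zero_left, Int.isUnit_iff] at hcop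
    omega
  have hcd' : γ 1 0 + 4 * γ 1 1 = 0 → γ 1 1 = 1 := by
    intro h
    have h2 : γ 1 1 ∣ γ 1 0 := ⟨-4, by linarith⟩
    have := Int.isUnit_iff.mp (hcop.isUnit_of_dvd' h2 dvd_rfl)
    omega
  generalize γ 1 0 = c at *
  generalize γ 1 1 = d at *
  generalize lowerFour • τ = w at *
  have hA : (((c + 4 * d : ℤ) : ℂ) * τ + d) = (c * w + d) * (4 * (τ : ℂ) + 1) := by
    push_cast; linear_combination -(c : ℂ) * hw
  have hAim : (((c + 4 * d : ℤ) : ℂ) * τ + d).im = (c + 4 * d : ℤ) * τ.im := by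
    rw [Complex.add_im, Complex.intCast_im, Complex.mul_im, Complex.intCast_im, Complex.intCast_re]
    simp
  have hQim : ((c : ℂ) * w + d).im = c * w.im := by simp
  have hBim : 0 < (4 * (τ : ℂ) + 1).im := by simpa using τ.im_pos
  have ht1 := sqrt_re_pos (Or.inr hBim.ne')
  have ht2 := sqrt_im_pos hBim
  have hsq : (((c : ℂ) * w + d) ^ (1 / 2 : ℂ) * (4 * (τ : ℂ) + 1) ^ (1 / 2 : ℂ)) ^ 2 =
      ((c + 4 * d : ℤ) : ℂ) * τ + d := by
    rw [mul_pow, sqrt_sq, sqrt_sq, hA]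
  rw [mul_assoc]
  -- For c < 0 the two roots lie in the fourth and first quadrants, and for c = 0 one of them is 1,
  -- so the product has positive real part. For c > 0 both lie in the first quadrant, so the product
  -- is in the upper half-plane and is compared with the principal root through the sign of c + 4d.
  rcases le_or_gt c 0 with hc0 | hc0
  · rw [kroneckerSymbol_add_mul_left hodd (by intro h; constructor <;> intro h <;> omega)]
    congr 1
    refine (eq_sqrt_of_sq hsq ?_).symm
    rw [Complex.mul_re, sub_pos]
    rcases hc0.eq_or_lt with h | h
    · rw [h, hcd h]
      simpa using ht1
    · have hQ : ((c : ℂ) * w + d).im < 0 := by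
        rw [hQim]; exact mul_neg_of_neg_of_pos (by exact_mod_cast h) w.im_pos
      have hs1 := sqrt_re_pos (Or.inr hQ.ne)
      have hs2 := sqrt_im_neg hQ
      nlinarith [mul_pos hs1 ht1, mul_pos (neg_pos.mpr hs2) ht2]
  · have hQ : 0 < ((c : ℂ) * w + d).im := by
      rw [hQim]; exact mul_pos (by exact_mod_cast hc0) w.im_pos
    have hs1 := sqrt_re_pos (Or.inr hQ.ne')
    have hs2 := sqrt_im_pos hQ
    have hst : 0 < (((c : ℂ) * w + d) ^ (1 / 2 : ℂ) * (4 * (τ : ℂ) + 1) ^ (1 / 2 : ℂ)).im := by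
      rw [Complex.mul_im]; positivity
    have hpm := sq_eq_sq_iff_eq_or_eq_neg.mp
      (hsq.trans (sqrt_sq (((c + 4 * d : ℤ) : ℂ) * τ + d)).symm)
    rcases lt_trichotomy (c + 4 * d) 0 with h | h | h
    · rw [kroneckerSymbol_add_mul_left_of_neg hodd (by omega) hc0.le h]
      have hA' := sqrt_im_neg (z := ((c + 4 * d : ℤ) : ℂ) * τ + d) (by
        rw [hAim]; exact mul_neg_of_neg_of_pos (by exact_mod_cast h) τ.im_pos)
      rcases hpm with hpm | hpm
      · rw [hpm] at hst; linarith
      · rw [hpm]; push_cast; ring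
    · have := hcd' h
      omega
    · rw [kroneckerSymbol_add_mul_left hodd (by intro h; constructor <;> intro h <;> omega)]
      have hA' := sqrt_im_pos (z := ((c + 4 * d : ℤ) : ℂ) * τ + d) (by
        rw [hAim]; exact mul_pos (by exact_mod_cast h) τ.im_pos)
      rcases hpm with hpm | hpm
      · rw [hpm]
      · rw [hpm, Complex.neg_im] at hst; linarith

theorem theta_T_smul (τ : ℍ) : theta ((T • τ : ℍ) : ℂ) = theta τ := by
  rw [UpperHalfPlane.modular_T_smul, UpperHalfPlane.coe_vadd, add_comm]
  exact_mod_cast theta_add_one τ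

/-- The theta multiplier on `Γ₁(4)`. -/
theorem theta_smul {γ : SL(2, ℤ)} (hc : 4 ∣ γ 1 0) (hd : γ 1 1 % 4 = 1) (τ : ℍ) :
    theta ((γ • τ : ℍ) : ℂ) = halfFactor γ τ * theta τ := by
  have key : ∀ τ : ℍ, theta ((γ • τ : ℍ) : ℂ) = halfFactor γ τ * theta τ := by
    refine gammaOneFour_induction
      (p := fun γ => ∀ τ : ℍ, theta ((γ • τ : ℍ) : ℂ) = halfFactor γ τ * theta τ)
      ?_ ?_ ?_ γ hc hd
    · intro τ
      simp [halfFactor, kroneckerSymbol]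
    · intro γ hc hd
      have h : ∀ τ : ℍ, theta (((γ * T) • τ : ℍ) : ℂ) = halfFactor (γ * T) τ * theta τ ↔
          theta ((γ • T • τ : ℍ) : ℂ) = halfFactor γ (T • τ) * theta ((T • τ : ℍ) : ℂ) := by
        intro τ
        rw [halfFactor_mul_T hc hd, mul_smul, theta_T_smul]
      simp only [h]
      exact ⟨fun H τ => by simpa using H (T⁻¹ • τ), fun H τ => H _⟩
    · intro γ hc hd
      have h : ∀ τ : ℍ, theta (((γ * lowerFour) • τ : ℍ) : ℂ) =
          halfFactor (γ * lowerFour) τ * theta τ ↔ theta ((γ • lowerFour • τ : ℍ) : ℂ) =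
            halfFactor γ (lowerFour • τ) * theta ((lowerFour • τ : ℍ) : ℂ) := by
        intro τ
        rw [halfFactor_mul_lowerFour hc hd, mul_smul, theta_lowerFour_smul, mul_assoc]
      simp only [h]
      exact ⟨fun H τ => by simpa using H (lowerFour⁻¹ • τ), fun H τ => H _⟩
  exact key τ

/-- Conjugation by τ ↦ τ/4 turns γ into (a b/4; 4c d), again in Γ₁(4), and (4c | d) = (c | d)
because d is odd. -/
theorem theta_div_four_smul {γ : SL(2, ℤ)} (hb : 4 ∣ γ 0 1) (hc : 4 ∣ γ 1 0)
    (hd : γ 1 1 % 4 = 1) (τ : ℍ) :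
    theta (((γ • τ : ℍ) : ℂ) / 4) = halfFactor γ τ * theta ((τ : ℂ) / 4) := by
  obtain ⟨b, hb⟩ := hb
  have hdet := γ.det_coe
  rw [Matrix.det_fin_two, hb] at hdet
  let δ : SL(2, ℤ) := ⟨!![γ 0 0, b; 4 * γ 1 0, γ 1 1], by
    rw [Matrix.det_fin_two_of]; linarith⟩
  have hδ : (δ : Matrix (Fin 2) (Fin 2) ℤ) = !![γ 0 0, b; 4 * γ 1 0, γ 1 1] := rfl
  let w : ℍ := ⟨(τ : ℂ) / 4, by simpa using τ.im_pos⟩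
  have hw : (w : ℂ) = τ / 4 := rfl
  have h := theta_smul (γ := δ) (by simp [hδ]) (by simpa [hδ] using hd) w
  have hodd : Odd (γ 1 1) := by rw [Int.odd_iff]; omega
  have e1 : ((δ • w : ℍ) : ℂ) = ((γ • τ : ℍ) : ℂ) / 4 := by
    rw [UpperHalfPlane.coe_specialLinearGroup_apply, UpperHalfPlane.coe_specialLinearGroup_apply,
      hδ, hw, hb]
    simp
    ring_nf
  have e2 : halfFactor δ w = halfFactor γ τ := by
    have h4 : kroneckerSymbol (4 * γ 1 0) (γ 1 1) = kroneckerSymbol (γ 1 0) (γ 1 1) := by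
      rw [kroneckerSymbol_of_odd _ hodd, kroneckerSymbol_of_odd _ hodd, jacobiSym.mul_left,
        jacobiSym.at_four (Int.natAbs_odd.mpr hodd), one_mul]
      congr 1
      split_ifs <;> first | rfl | omega
    have h1 : δ 1 0 = 4 * γ 1 0 := rfl
    have h2 : δ 1 1 = γ 1 1 := rfl
    rw [halfFactor, halfFactor, h1, h2, h4, hw]
    congr 2
    push_cast; ring
  rw [← e1, h, e2, hw]

/-! ### The slash operator -/

theorem lower_row_ne_zero (γ : SL(2, ℤ)) (τ : ℍ) :
    ((γ 1 0 : ℤ) : ℂ) * (τ : ℂ) + ((γ 1 1 : ℤ) : ℂ) ≠ 0 := by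
  have h := UpperHalfPlane.denom_ne_zero γ τ
  rwa [ModularGroup.denom_apply] at h

theorem halfFactor_ne_zero (γ : SL(2, ℤ)) (τ : ℍ) : halfFactor γ τ ≠ 0 := by
  intro h
  have h1 := halfFactor_sq γ τ
  rw [h] at h1
  exact lower_row_ne_zero γ τ (by rw [← h1]; norm_num)

theorem lower_row_mul (α β : SL(2, ℤ)) (τ : ℍ) :
    (((α * β) 1 0 : ℤ) : ℂ) * (τ : ℂ) + (((α * β) 1 1 : ℤ) : ℂ) =
      (((α 1 0 : ℤ) : ℂ) * ((β • τ : ℍ) : ℂ) + ((α 1 1 : ℤ) : ℂ)) *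
        (((β 1 0 : ℤ) : ℂ) * (τ : ℂ) + ((β 1 1 : ℤ) : ℂ)) := by
  have h := lower_row_ne_zero β τ
  rw [UpperHalfPlane.coe_specialLinearGroup_apply, Matrix.SpecialLinearGroup.coe_mul]
  simp only [Matrix.mul_apply, Fin.sum_univ_two, algebraMap_int_eq, eq_intCast,
    Complex.ofReal_intCast]
  rw [add_mul, mul_assoc, div_mul_cancel₀ _ h]
  push_cast
  ring

theorem lower_row_mem_slitPlane_or (γ : SL(2, ℤ)) :
    (∀ τ : ℍ, ((γ 1 0 : ℤ) : ℂ) * (τ : ℂ) + ((γ 1 1 : ℤ) : ℂ) ∈ Complex.slitPlane) ∨ γ 1 0 = 0 := by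
  rcases eq_or_ne (γ 1 0) 0 with h | h
  · exact Or.inr h
  · refine Or.inl fun τ => Or.inr ?_
    simpa using ⟨h, τ.im_ne_zero⟩

theorem mdifferentiable_of_differentiableOn {g : ℂ → ℂ}
    (hg : DifferentiableOn ℂ g UpperHalfPlane.upperHalfPlaneSet) :
    MDifferentiable 𝓘(ℂ) 𝓘(ℂ) (fun τ : ℍ => g τ) := by
  rw [UpperHalfPlane.mdifferentiable_iff]
  refine hg.congr fun z hz => ?_
  simp [UpperHalfPlane.ofComplex_apply_of_im_pos hz]

theorem mdifferentiable_halfFactor (γ : SL(2, ℤ)) :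
    MDifferentiable 𝓘(ℂ) 𝓘(ℂ) (halfFactor γ) := by
  apply mdifferentiable_of_differentiableOn (g := fun z =>
    (kroneckerSymbol (γ 1 0) (γ 1 1) : ℂ) * (((γ 1 0 : ℤ) : ℂ) * z + ((γ 1 1 : ℤ) : ℂ)) ^ (1 / 2 : ℂ))
  rcases lower_row_mem_slitPlane_or γ with h | h
  · intro z hz
    refine (DifferentiableAt.const_mul (DifferentiableAt.cpow_const (by fun_prop) ?_) _).differentiableWithinAt
    exact h ⟨z, hz⟩
  · rw [h]
    simp only [Int.cast_zero, zero_mul, zero_add]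
    fun_prop

/-- The automorphy factor is a cocycle up to a constant sign. -/
theorem halfFactor_mul (α β : SL(2, ℤ)) : ∃ ε : ℂ, ε ^ 2 = 1 ∧ ∀ τ : ℍ,
    halfFactor (α * β) τ = ε * (halfFactor α (β • τ) * halfFactor β τ) := by
  have hc : ∀ γ, Continuous (halfFactor γ) := fun γ => (mdifferentiable_halfFactor γ).continuous
  have hs : Continuous fun τ : ℍ => β • τ := by
    have : (fun τ : ℍ => β • τ) = fun τ : ℍ => (β : GL (Fin 2) ℝ) • τ := rfl
    rw [this]
    exact continuous_const_smul _
  -- The squares agree by the cocycle relation for cτ + d. Two continuous functions without zeros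
  -- and with equal squares differ by one global sign on the connected space ℍ.
  have h := (isPreconnected_univ (α := ℍ)).eq_or_eq_neg_of_sq_eq (f := halfFactor (α * β))
    (g := fun τ => halfFactor α (β • τ) * halfFactor β τ) (hc _).continuousOn
    (((hc α).comp hs).mul (hc β)).continuousOn
    (fun τ _ => by
      simp only [Pi.pow_apply, mul_pow, halfFactor_sq]
      exact lower_row_mul α β τ)
    (fun {τ} _ => mul_ne_zero (halfFactor_ne_zero _ _) (halfFactor_ne_zero _ _))
  rcases h with h | h
  · exact ⟨1, by norm_num, fun τ => by rw [one_mul]; exact h (Set.mem_univ τ)⟩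
  · exact ⟨-1, by norm_num, fun τ => by
      rw [neg_one_mul]; exact h (Set.mem_univ τ)⟩

theorem halfSlash_mul_group (k : ℕ) (α β : SL(2, ℤ)) : ∃ ε : ℂ, ε ^ 2 = 1 ∧ ∀ f : ℍ → ℂ,
    halfSlash k f (α * β) = ε • halfSlash k (halfSlash k f α) β := by
  obtain ⟨ε, hε, h⟩ := halfFactor_mul α β
  refine ⟨ε ^ k, by rw [← pow_mul, mul_comm, pow_mul, hε, one_pow], fun f => ?_⟩
  ext τ
  have h0 : ε ^ k * ε ^ k = 1 := by rw [← mul_pow, ← sq, hε, one_pow]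
  have h1 : ε ^ k ≠ 0 := left_ne_zero_of_mul_eq_one h0
  simp only [halfSlash, Pi.smul_apply, smul_eq_mul, h, mul_pow, mul_smul]
  rw [div_eq_iff (by simp [h1, halfFactor_ne_zero])]
  have h2 := halfFactor_ne_zero α (β • τ)
  have h3 := halfFactor_ne_zero β τ
  field_simp
  rw [sq, h0, mul_one]

theorem halfFactor_one (τ : ℍ) : halfFactor 1 τ = 1 := by
  simp [halfFactor, kroneckerSymbol]

theorem halfSlash_one_group (k : ℕ) (f : ℍ → ℂ) : halfSlash k f 1 = f := by
  ext τ; simp [halfSlash, halfFactor_one]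

theorem halfFactor_T_zpow (n : ℤ) (τ : ℍ) : halfFactor (T ^ n) τ = 1 := by
  have h := coe_T_zpow n
  have h1 : (T ^ n) 1 0 = 0 := by rw [h]; simp
  have h2 : (T ^ n) 1 1 = 1 := by rw [h]; simp
  rw [halfFactor, h1, h2]
  simp [kroneckerSymbol]

theorem halfFactor_S (τ : ℍ) : halfFactor S τ = (τ : ℂ) ^ (1 / 2 : ℂ) := by
  have h1 : S 1 0 = 1 := by simp [S]
  have h2 : S 1 1 = 0 := by simp [S]
  rw [halfFactor, h1, h2]
  simp [kroneckerSymbol]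

/-! ### The theta functions with even and odd summation index -/

/-- `θ(τ)`, the sum over the even integers in `θ(τ/4)`. -/
noncomputable def thetaEven (τ : ℍ) : ℂ := theta τ

/-- `θ(τ/4) - θ(τ)`, the sum over the odd integers in `θ(τ/4)`. -/
noncomputable def thetaOdd (τ : ℍ) : ℂ := theta ((τ : ℂ) / 4) - theta τ

theorem differentiableAt_theta {z : ℂ} (hz : 0 < z.im) : DifferentiableAt ℂ theta z := by
  rw [show theta = jacobiTheta ∘ (fun z => 2 * z) from funext theta_eq_jacobiTheta]
  exact (differentiableAt_jacobiTheta (by simpa using hz)).comp z (by fun_prop)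

theorem mdifferentiable_thetaEven : MDifferentiable 𝓘(ℂ) 𝓘(ℂ) thetaEven :=
  mdifferentiable_of_differentiableOn fun _ hz => (differentiableAt_theta hz).differentiableWithinAt

theorem mdifferentiable_thetaOdd : MDifferentiable 𝓘(ℂ) 𝓘(ℂ) thetaOdd := by
  apply mdifferentiable_of_differentiableOn (g := fun z => theta (z / 4) - theta z)
  intro z hz
  refine DifferentiableAt.differentiableWithinAt (.sub ?_ (differentiableAt_theta hz))
  exact DifferentiableAt.comp (f := fun z : ℂ => z / 4) z
    (differentiableAt_theta (by simpa using hz)) (by fun_prop)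

theorem summable_theta {z : ℂ} (hz : 0 < z.im) :
    Summable fun n : ℤ => Complex.exp (2 * Real.pi * Complex.I * (n : ℂ) ^ 2 * z) := by
  have := (hasSum_jacobiTheta₂_term 0 (τ := 2 * z) (by simpa using hz)).summable
  refine this.congr fun n => ?_
  simp only [jacobiTheta₂_term]
  congr 1; ring

theorem thetaEven_T_smul (τ : ℍ) : thetaEven (T • τ) = thetaEven τ := theta_T_smul τ

theorem thetaOdd_T_smul (τ : ℍ) : thetaOdd (T • τ) = Complex.I * thetaOdd τ := by
  have h4 : 0 < ((τ : ℂ) / 4).im := by simpa using τ.im_pos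
  have key : theta ((τ : ℂ) / 4 + 1 / 4) - Complex.I * theta ((τ : ℂ) / 4) =
      (1 - Complex.I) * theta τ := by
    have h4' : 0 < ((τ : ℂ) / 4 + 1 / 4).im := by simpa using τ.im_pos
    unfold theta
    rw [← tsum_mul_left, ← tsum_mul_left, ← (summable_theta h4').tsum_sub ((summable_theta h4).mul_left _)]
    have hinj : Function.Injective fun n : ℤ => 2 * n := fun a b h => by simpa using h
    have e : ∀ n : ℤ, Complex.exp (2 * Real.pi * Complex.I * (n : ℂ) ^ 2 * ((τ : ℂ) / 4 + 1 / 4)) =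
        Complex.I ^ (n ^ 2) *
          Complex.exp (2 * Real.pi * Complex.I * (n : ℂ) ^ 2 * ((τ : ℂ) / 4)) := by
      intro n
      rw [mul_add, Complex.exp_add, mul_comm]
      congr 1
      conv_rhs => rw [← Complex.exp_pi_div_two_mul_I, ← Complex.exp_int_mul]
      congr 1; push_cast; ring
    -- The coefficient i^{n²} - i vanishes for odd n, so only even indices survive, and there i^{n²}
    -- = 1.
    rw [← hinj.tsum_eq]
    · refine tsum_congr fun n => ?_
      rw [e, show (2 * n) ^ 2 = 4 * n ^ 2 by ring, zpow_mul]
      have : Complex.I ^ (4 : ℤ) = 1 := Complex.I_pow_four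
      rw [this, one_zpow, one_mul, ← one_sub_mul]
      congr 2; push_cast; ring
    · intro n hn
      rw [Function.mem_support, e, ← sub_mul] at hn
      rcases Int.even_or_odd' n with ⟨m, rfl | rfl⟩
      · exact ⟨m, rfl⟩
      · refine absurd ?_ hn
        rw [show (2 * m + 1) ^ 2 = 4 * (m ^ 2 + m) + 1 by ring, zpow_add₀ Complex.I_ne_zero,
          zpow_mul]
        have : Complex.I ^ (4 : ℤ) = 1 := Complex.I_pow_four
        rw [this, one_zpow, one_mul, zpow_one, sub_self, zero_mul]
  have h := theta_T_smul τ
  rw [thetaOdd, thetaOdd, h, UpperHalfPlane.modular_T_smul, UpperHalfPlane.coe_vadd]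
  push_cast
  rw [add_comm, add_div]
  linear_combination key

theorem sqrt_neg_I_half_mul (τ : ℍ) : (-2 * Complex.I * ((τ : ℂ) / 4)) ^ (1 / 2 : ℂ) =
    (1 - Complex.I) / 2 * (τ : ℂ) ^ (1 / 2 : ℂ) := by
  refine (eq_sqrt_of_sq ?_ ?_).symm
  · rw [mul_pow, sqrt_sq, div_pow, sub_sq, Complex.I_sq]; ring
  · have h1 := sqrt_re_pos (z := τ) (Or.inr τ.im_ne_zero)
    have h2 := sqrt_im_pos (z := τ) τ.im_pos
    rw [show (1 - Complex.I) / 2 = ((1 / 2 : ℝ) : ℂ) * (1 - Complex.I) by push_cast; ring,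
      mul_assoc, Complex.re_ofReal_mul, Complex.mul_re]
    simp only [Complex.sub_re, Complex.one_re, Complex.I_re, Complex.sub_im, Complex.one_im,
      Complex.I_im]
    linarith

theorem sqrt_neg_two_I_mul (τ : ℍ) : (-2 * Complex.I * (τ : ℂ)) ^ (1 / 2 : ℂ) =
    (1 - Complex.I) * (τ : ℂ) ^ (1 / 2 : ℂ) := by
  refine (eq_sqrt_of_sq ?_ ?_).symm
  · rw [mul_pow, sqrt_sq, sub_sq, Complex.I_sq]; ring
  · have h1 := sqrt_re_pos (z := τ) (Or.inr τ.im_ne_zero)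
    have h2 := sqrt_im_pos (z := τ) τ.im_pos
    rw [Complex.mul_re]
    simp only [Complex.sub_re, Complex.one_re, Complex.I_re, Complex.sub_im, Complex.one_im,
      Complex.I_im]
    linarith

theorem thetaEven_S_smul (τ : ℍ) : thetaEven (S • τ) =
    (1 - Complex.I) / 2 * (τ : ℂ) ^ (1 / 2 : ℂ) * (thetaEven τ + thetaOdd τ) := by
  have h := theta_neg_inv (τ := (τ : ℂ) / 4) (by simpa using τ.im_pos)
  rw [sqrt_neg_I_half_mul] at h
  rw [thetaEven, thetaEven, thetaOdd, UpperHalfPlane.modular_S_smul, add_sub_cancel, ← h]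
  congr 1
  simp only
  have := τ.ne_zero
  field_simp

theorem thetaOdd_S_smul (τ : ℍ) : thetaOdd (S • τ) =
    (1 - Complex.I) / 2 * (τ : ℂ) ^ (1 / 2 : ℂ) * (thetaEven τ - thetaOdd τ) := by
  have h := theta_neg_inv τ.im_pos
  have h2 := thetaEven_S_smul τ
  rw [sqrt_neg_two_I_mul] at h
  have h3 : theta (((S • τ : ℍ) : ℂ) / 4) = theta (-1 / (4 * (τ : ℂ))) := by
    rw [UpperHalfPlane.modular_S_smul]
    congr 1
    simp only
    have := τ.ne_zero
    field_simp
  have h4 : thetaOdd (S • τ) = theta (((S • τ : ℍ) : ℂ) / 4) - thetaEven (S • τ) := rfl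
  rw [h4, h3, h, h2, thetaEven]
  ring

theorem thetaEven_T_zpow_smul (n : ℤ) (τ : ℍ) : thetaEven (T ^ n • τ) = thetaEven τ := by
  induction n generalizing τ with
  | zero => simp
  | succ n ih => rw [zpow_add, mul_smul, ih, zpow_one, thetaEven_T_smul]
  | pred n ih =>
    rw [zpow_sub, mul_smul, ih, ← thetaEven_T_smul, zpow_one, smul_inv_smul]

theorem thetaOdd_T_zpow_smul (n : ℤ) (τ : ℍ) :
    thetaOdd (T ^ n • τ) = Complex.I ^ n * thetaOdd τ := by
  have hI := Complex.I_ne_zero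
  induction n generalizing τ with
  | zero => simp
  | succ n ih =>
    rw [zpow_add, mul_smul, ih, zpow_one, thetaOdd_T_smul, zpow_add₀ hI, zpow_one, mul_assoc]
  | pred n ih =>
    have h := thetaOdd_T_smul ((T ^ (1 : ℤ))⁻¹ • τ)
    rw [zpow_one, smul_inv_smul] at h
    rw [zpow_sub, mul_smul, ih, zpow_one, h, zpow_sub₀ hI, zpow_one]
    field_simp

end HalfIntegralWeight

namespace HalfIntegralWeight
open ModularGroup UpperHalfPlane Filter Topology Asymptotics
open scoped ModularForm

/-! ### Behaviour at `i∞` -/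

theorem tendsto_ofReal_mul_coe_atImInfty {r : ℝ} (hr : 0 < r) :
    Tendsto (fun τ : ℍ => (r : ℂ) * (τ : ℂ)) atImInfty (comap Complex.im atTop) := by
  rw [tendsto_comap_iff]
  have : Complex.im ∘ (fun τ : ℍ => (r : ℂ) * (τ : ℂ)) = fun τ : ℍ => r * τ.im := by
    ext τ; simp
  rw [this]
  exact tendsto_comap.const_mul_atTop hr

theorem tendsto_jacobiTheta : Tendsto jacobiTheta (comap Complex.im atTop) (𝓝 1) := by
  have h : Tendsto (fun τ : ℂ => Real.exp (-Real.pi * τ.im)) (comap Complex.im atTop) (𝓝 0) := by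
    refine Real.tendsto_exp_atBot.comp ?_
    exact tendsto_comap.const_mul_atTop_of_neg (by simpa using Real.pi_pos)
  have := (isBigO_at_im_infty_jacobiTheta_sub_one.trans_tendsto h).add_const 1
  simpa using this

theorem tendsto_thetaEven : Tendsto thetaEven atImInfty (𝓝 1) := by
  refine (tendsto_jacobiTheta.comp (tendsto_ofReal_mul_coe_atImInfty two_pos)).congr fun τ => ?_
  simp [thetaEven, theta_eq_jacobiTheta]

theorem tendsto_thetaOdd : Tendsto thetaOdd atImInfty (𝓝 0) := by
  have h := (tendsto_jacobiTheta.comp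
    (tendsto_ofReal_mul_coe_atImInfty (r := 1 / 2) (by norm_num))).sub tendsto_thetaEven
  rw [sub_self] at h
  refine h.congr fun τ => ?_
  rw [thetaOdd, thetaEven, theta_eq_jacobiTheta ((τ : ℂ) / 4), Function.comp_apply]
  congr 2; push_cast; ring

/-! ### The space spanned by the theta functions -/

/-- The space spanned by `θ(τ)` and `θ(τ/4)`. -/
noncomputable def thetaSpace : Submodule ℂ (ℍ → ℂ) := Submodule.span ℂ {thetaEven, thetaOdd}

theorem mem_thetaSpace {f : ℍ → ℂ} :
    f ∈ thetaSpace ↔ ∃ a b : ℂ, a • thetaEven + b • thetaOdd = f :=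
  Submodule.mem_span_pair

theorem thetaEven_mem_thetaSpace : thetaEven ∈ thetaSpace :=
  Submodule.subset_span (by simp)

theorem thetaOdd_mem_thetaSpace : thetaOdd ∈ thetaSpace :=
  Submodule.subset_span (by simp)

theorem tendsto_linear_combination_theta (a b : ℂ) :
    Tendsto (a • thetaEven + b • thetaOdd) atImInfty (𝓝 a) := by
  have := (tendsto_thetaEven.const_mul a).add (tendsto_thetaOdd.const_mul b)
  rw [mul_one, mul_zero, add_zero] at this
  exact this

/-- The linear operator `f ↦ f|_{k/2} γ`. -/
noncomputable def halfSlashLinear (k : ℕ) (γ : SL(2, ℤ)) : (ℍ → ℂ) →ₗ[ℂ] (ℍ → ℂ) where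
  toFun f := halfSlash k f γ
  map_add' f g := halfSlash_add k f g γ
  map_smul' a f := halfSlash_smul k a f γ

theorem halfSlash_T_zpow (k : ℕ) (f : ℍ → ℂ) (n : ℤ) (τ : ℍ) :
    halfSlash k f (T ^ n) τ = f (T ^ n • τ) := by
  simp [halfSlash, halfFactor_T_zpow]

theorem halfSlash_thetaEven_S :
    halfSlash 1 thetaEven S = ((1 - Complex.I) / 2) • (thetaEven + thetaOdd) := by
  ext τ
  have := sqrt_ne_zero τ.ne_zero
  rw [halfSlash, halfFactor_S, thetaEven_S_smul]
  simp only [Pi.smul_apply, Pi.add_apply, smul_eq_mul]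
  field_simp

theorem halfSlash_thetaOdd_S :
    halfSlash 1 thetaOdd S = ((1 - Complex.I) / 2) • (thetaEven - thetaOdd) := by
  ext τ
  have := sqrt_ne_zero τ.ne_zero
  rw [halfSlash, halfFactor_S, thetaOdd_S_smul]
  simp only [Pi.smul_apply, Pi.sub_apply, smul_eq_mul]
  field_simp

/-- Stability under S and T suffices: the sign by which the slash operator fails to be an action
does not affect membership in a subspace. -/
theorem halfSlash_mem_thetaSpace (α : SL(2, ℤ)) :
    ∀ f ∈ thetaSpace, halfSlash 1 f α ∈ thetaSpace := by
  set p : SL(2, ℤ) → Prop := fun α => ∀ f ∈ thetaSpace, halfSlash 1 f α ∈ thetaSpace with hp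
  have gen : ∀ α, halfSlash 1 thetaEven α ∈ thetaSpace → halfSlash 1 thetaOdd α ∈ thetaSpace →
      p α := by
    intro α h1 h2
    change thetaSpace ≤ thetaSpace.comap (halfSlashLinear 1 α)
    refine Submodule.span_le.mpr ?_
    rintro f (rfl | rfl)
    · exact h1
    · exact h2
  have mul : ∀ α β, p α → p β → p (α * β) := by
    intro α β hα hβ f hf
    obtain ⟨ε, -, h⟩ := halfSlash_mul_group 1 α β
    rw [h]
    exact thetaSpace.smul_mem _ (hβ _ (hα _ hf))
  have hT : ∀ n : ℤ, p (T ^ n) := by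
    intro n
    refine gen _ ?_ ?_
    · convert thetaEven_mem_thetaSpace using 1
      ext τ; rw [halfSlash_T_zpow, thetaEven_T_zpow_smul]
    · convert thetaSpace.smul_mem (Complex.I ^ n) thetaOdd_mem_thetaSpace using 1
      ext τ; rw [halfSlash_T_zpow, thetaOdd_T_zpow_smul]; rfl
  have hS : p S := by
    refine gen _ ?_ ?_
    · rw [halfSlash_thetaEven_S]
      exact thetaSpace.smul_mem _ (thetaSpace.add_mem thetaEven_mem_thetaSpace thetaOdd_mem_thetaSpace)
    · rw [halfSlash_thetaOdd_S]
      exact thetaSpace.smul_mem _ (thetaSpace.sub_mem thetaEven_mem_thetaSpace thetaOdd_mem_thetaSpace)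
  -- The inverse of S is again a product of generators; the induction below carries α and α⁻¹
  -- together.
  have hS' : S⁻¹ = S * S * S := by decide
  have h : α ∈ Subgroup.closure {S, T} := by simp [SpecialLinearGroup.SL2Z_generators]
  suffices p α ∧ p α⁻¹ from this.1
  induction h using Subgroup.closure_induction with
  | mem x hx =>
    rcases hx with rfl | rfl
    · exact ⟨hS, by rw [hS']; exact mul _ _ (mul _ _ hS hS) hS⟩
    · exact ⟨by simpa using hT 1, by simpa using hT (-1)⟩
  | one => rw [inv_one, and_self]; simpa using hT 0
  | mul x y _ _ hx hy => exact ⟨mul _ _ hx.1 hy.1, by rw [mul_inv_rev]; exact mul _ _ hy.2 hx.2⟩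
  | inv x _ hx => exact ⟨hx.2, by rw [inv_inv]; exact hx.1⟩

theorem gamma_four_entries {γ : SL(2, ℤ)} (h : γ ∈ Gamma 4) :
    4 ∣ γ 0 1 ∧ 4 ∣ γ 1 0 ∧ γ 1 1 % 4 = 1 := by
  obtain ⟨-, hb, hc, hd⟩ := Gamma_mem.mp h
  refine ⟨(ZMod.intCast_zmod_eq_zero_iff_dvd _ 4).mp hb,
    (ZMod.intCast_zmod_eq_zero_iff_dvd _ 4).mp hc, ?_⟩
  have : ((γ 1 1 : ℤ) : ZMod 4) = ((1 : ℤ) : ZMod 4) := by simpa using hd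
  simpa using (ZMod.intCast_eq_intCast_iff' _ _ 4).mp this

theorem thetaEven_smul {γ : SL(2, ℤ)} (h : γ ∈ Gamma 4) (τ : ℍ) :
    thetaEven (γ • τ) = halfFactor γ τ * thetaEven τ := by
  obtain ⟨-, hc, hd⟩ := gamma_four_entries h
  exact theta_smul hc hd τ

theorem thetaOdd_smul {γ : SL(2, ℤ)} (h : γ ∈ Gamma 4) (τ : ℍ) :
    thetaOdd (γ • τ) = halfFactor γ τ * thetaOdd τ := by
  obtain ⟨hb, hc, hd⟩ := gamma_four_entries h
  rw [thetaOdd, theta_smul hc hd, theta_div_four_smul hb hc hd, thetaOdd]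
  ring

theorem thetaSpace_le_modForms : thetaSpace ≤ modForms (Gamma 4) 1 := by
  have bdd : ∀ f ∈ thetaSpace, IsBoundedAtImInfty f := by
    intro f hf
    obtain ⟨a, b, rfl⟩ := mem_thetaSpace.mp hf
    exact (tendsto_linear_combination_theta a b).isBigO_one ℝ
  refine Submodule.span_le.mpr ?_
  rintro f (rfl | rfl)
  · refine ⟨mdifferentiable_thetaEven, fun γ hγ => ?_,
      fun α => bdd _ (halfSlash_mem_thetaSpace α _ thetaEven_mem_thetaSpace)⟩
    ext τ
    rw [halfSlash, thetaEven_smul hγ, pow_one, mul_div_cancel_left₀ _ (halfFactor_ne_zero γ τ)]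
  · refine ⟨mdifferentiable_thetaOdd, fun γ hγ => ?_,
      fun α => bdd _ (halfSlash_mem_thetaSpace α _ thetaOdd_mem_thetaSpace)⟩
    ext τ
    rw [halfSlash, thetaOdd_smul hγ, pow_one, mul_div_cancel_left₀ _ (halfFactor_ne_zero γ τ)]

theorem thetaEven_mem_modForms : thetaEven ∈ modForms (Gamma 4) 1 :=
  thetaSpace_le_modForms thetaEven_mem_thetaSpace

theorem thetaOdd_mem_modForms : thetaOdd ∈ modForms (Gamma 4) 1 :=
  thetaSpace_le_modForms thetaOdd_mem_thetaSpace

/-! ### Forms of weight zero -/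

/-- A holomorphic function invariant under `Γ(4)` and bounded at all cusps is constant. -/
theorem eq_const_of_gamma_four {G : ℍ → ℂ} (hol : MDifferentiable 𝓘(ℂ) 𝓘(ℂ) G)
    (inv : ∀ γ ∈ Gamma 4, ∀ τ : ℍ, G (γ • τ) = G τ)
    (bdd : ∀ α : SL(2, ℤ), IsBoundedAtImInfty fun τ => G (α • τ)) : ∃ c, ∀ τ, G τ = c := by
  let g : ModularForm ((Gamma 4).map (Matrix.SpecialLinearGroup.mapGL ℝ)) 0 :=
    { toFun := G
      slash_action_eq' := by
        rintro _ ⟨γ, hγ, rfl⟩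
        ext τ
        have := inv γ hγ τ
        change (G ∣[(0 : ℤ)] γ) τ = G τ
        rw [ModularForm.SL_slash_apply]
        simpa using this
      holo' := hol
      bdd_at_cusps' := by
        intro c hc
        rw [Subgroup.IsArithmetic.isCusp_iff_isCusp_SL2Z] at hc
        rw [OnePoint.isBoundedAt_iff_forall_SL2Z hc]
        intro α _
        convert bdd α using 1
        ext τ
        rw [ModularForm.SL_slash_apply]
        simp }
  obtain ⟨c, hc⟩ := ModularForm.eq_const_of_weight_zero g
  exact ⟨c, fun τ => congrFun hc τ⟩

/-! ### The Dedekind eta function -/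

/-- The Euler product `∏ (1 - q ^ n)`. -/
noncomputable def eulerProd (q : ℂ) : ℂ := ∏' n : ℕ, (1 - q ^ (n + 1))

theorem eta_eq_eulerProd (z : ℂ) :
    ModularForm.eta z = Function.Periodic.qParam 24 z * eulerProd (Function.Periodic.qParam 1 z) :=
  rfl

theorem tendsto_eulerProd : Tendsto eulerProd (𝓝 0) (𝓝 1) := by
  have h := (ModularForm.differentiableOn_tprod_one_sub_pow.differentiableAt
    (Metric.isOpen_ball.mem_nhds (Metric.mem_ball_self one_pos))).continuousAt.tendsto
  simpa [eulerProd] using! h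

theorem tendsto_eulerProd_qParam {r : ℝ} (hr : 0 < r) :
    Tendsto (fun τ : ℍ => eulerProd (Function.Periodic.qParam 1 ((r : ℂ) * τ))) atImInfty (𝓝 1) :=
  tendsto_eulerProd.comp (((Function.Periodic.qParam_tendsto one_pos).mono_right
    nhdsWithin_le_nhds).comp (tendsto_ofReal_mul_coe_atImInfty hr))

theorem eta_ne_zero' (τ : ℍ) {r : ℝ} (hr : 0 < r) : ModularForm.eta ((r : ℂ) * τ) ≠ 0 :=
  ModularForm.eta_ne_zero (by simpa using mul_pos hr τ.im_pos)

theorem eta_add_one (z : ℂ) :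
    ModularForm.eta (z + 1) = Complex.exp (2 * Real.pi * Complex.I / 24) * ModularForm.eta z := by
  have h1 : Function.Periodic.qParam 1 (z + 1) = Function.Periodic.qParam 1 z := by
    have h := Complex.exp_periodic (2 * Real.pi * Complex.I * z)
    simp only [Function.Periodic.qParam, Complex.ofReal_one, div_one]
    rw [← h]; congr 1; ring
  rw [eta_eq_eulerProd, eta_eq_eulerProd, h1, ← mul_assoc]
  congr 1
  rw [Function.Periodic.qParam, Function.Periodic.qParam, ← Complex.exp_add]
  congr 1; push_cast; ring

theorem eta_neg_inv {z : ℂ} (hz : 0 < z.im) : ModularForm.eta (-1 / z) =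
    (Complex.I ^ (1 / 2 : ℂ))⁻¹ * (z ^ (1 / 2 : ℂ) * ModularForm.eta z) := by
  have h := ModularForm.eta_comp_eq_csqrt_I_inv (x := z) hz
  simpa [Complex.sqrt] using h

/-- The function `η ^ 6`. -/
noncomputable def etaSix (τ : ℍ) : ℂ := ModularForm.eta τ ^ 6

theorem etaSix_ne_zero (τ : ℍ) : etaSix τ ≠ 0 := pow_ne_zero _ (ModularForm.eta_ne_zero τ.2)

theorem mdifferentiable_etaSix : MDifferentiable 𝓘(ℂ) 𝓘(ℂ) etaSix :=
  mdifferentiable_of_differentiableOn (g := fun z => ModularForm.eta z ^ 6) fun _ hz =>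
    ((ModularForm.differentiableAt_eta_of_mem_upperHalfPlaneSet hz).pow 6).differentiableWithinAt

theorem etaSix_T_smul (τ : ℍ) : etaSix (T • τ) = Complex.I * etaSix τ := by
  rw [etaSix, modular_T_smul, coe_vadd, add_comm]
  push_cast
  rw [eta_add_one, mul_pow, ← Complex.exp_nat_mul, etaSix]
  congr 1
  conv_rhs => rw [← Complex.exp_pi_div_two_mul_I]
  congr 1; push_cast; ring

theorem etaSix_S_smul (τ : ℍ) : etaSix (S • τ) = Complex.I * (τ : ℂ) ^ 3 * etaSix τ := by
  have e : ((S • τ : ℍ) : ℂ) = -1 / (τ : ℂ) := by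
    rw [modular_S_smul, neg_div, one_div, ← inv_neg]
  have h6 : ∀ z : ℂ, (z ^ (1 / 2 : ℂ)) ^ 6 = z ^ 3 := fun z => by
    rw [show 6 = 2 * 3 by norm_num, pow_mul, sqrt_sq]
  rw [etaSix, e, eta_neg_inv τ.im_pos, mul_pow, mul_pow, inv_pow, h6, h6, etaSix, Complex.I_pow_three]
  field_simp
  rw [Complex.I_sq]; ring

/-- The product of the six theta functions vanishing at one of the six cusps of `Γ(4)`. -/
noncomputable def thetaProd : ℍ → ℂ := thetaEven * thetaOdd * (thetaEven ^ 4 - thetaOdd ^ 4)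

/-! ### The product identity for η⁶ and its consequences. -/

theorem thetaProd_mem_modForms : thetaProd ∈ modForms (Gamma 4) 6 := by
  have h4 : thetaEven ^ 4 ∈ modForms (Gamma 4) 4 :=
    SetLike.pow_mem_graded 4 thetaEven_mem_modForms
  have h4' : thetaOdd ^ 4 ∈ modForms (Gamma 4) 4 :=
    SetLike.pow_mem_graded 4 thetaOdd_mem_modForms
  exact SetLike.mul_mem_graded (i := 2) (j := 4)
    (SetLike.mul_mem_graded (i := 1) (j := 1) thetaEven_mem_modForms thetaOdd_mem_modForms)
    (Submodule.sub_mem _ h4 h4')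

theorem thetaProd_T_smul (τ : ℍ) : thetaProd (T • τ) = Complex.I * thetaProd τ := by
  simp only [thetaProd, Pi.mul_apply, Pi.sub_apply, Pi.pow_apply, thetaEven_T_smul, thetaOdd_T_smul,
    mul_pow, Complex.I_pow_four]
  ring

theorem thetaProd_S_smul (τ : ℍ) : thetaProd (S • τ) = Complex.I * (τ : ℂ) ^ 3 * thetaProd τ := by
  simp only [thetaProd, Pi.mul_apply, Pi.sub_apply, Pi.pow_apply, thetaEven_S_smul, thetaOdd_S_smul]
  have h := sqrt_sq τ
  generalize (τ : ℂ) ^ (1 / 2 : ℂ) = s at *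
  rw [← h]
  generalize thetaEven τ = x
  generalize thetaOdd τ = y
  have h6 : ((1 - Complex.I) / 2) ^ 6 = Complex.I / 8 := by
    have : ((1 - Complex.I) / 2) ^ 2 = -Complex.I / 2 := by
      rw [div_pow, sub_sq, Complex.I_sq]; ring
    have e : ((1 - Complex.I) / 2) ^ 6 = (((1 - Complex.I) / 2) ^ 2) ^ 3 := by ring
    rw [e, this, div_pow, neg_pow, Complex.I_pow_three]
    ring
  generalize (1 - Complex.I) / 2 = κ at *
  -- Substituting x + y and x - y for x and y multiplies xy(x⁴ - y⁴) by 8, which cancels the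
  -- denominator of κ⁶ = i/8.
  linear_combination (8 * s ^ 6 * x * y * (x ^ 4 - y ^ 4)) * h6

theorem tendsto_thetaEven_pow_sub : Tendsto (thetaEven ^ 4 - thetaOdd ^ 4) atImInfty (𝓝 1) := by
  have := (tendsto_thetaEven.pow 4).sub (tendsto_thetaOdd.pow 4)
  simp only [one_pow, ne_eq, OfNat.ofNat_ne_zero, not_false_eq_true, zero_pow, sub_zero] at this
  exact this

/-- A product of holomorphic functions on ℍ is zero only if a factor is. E and E⁴ - O⁴ tend to 1 at
i∞, and O = 0 would force E = 0 through S. -/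
theorem thetaProd_ne_zero : thetaProd ≠ 0 := by
  have hne : ∀ {f : ℍ → ℂ}, Tendsto f atImInfty (𝓝 1) → f ≠ 0 := by
    rintro f hf rfl
    exact zero_ne_one (tendsto_nhds_unique tendsto_const_nhds hf)
  intro h
  have hd : MDifferentiable 𝓘(ℂ) 𝓘(ℂ) (thetaEven ^ 4 - thetaOdd ^ 4) :=
    (mdifferentiable_thetaEven.pow 4).sub (mdifferentiable_thetaOdd.pow 4)
  rw [thetaProd, UpperHalfPlane.mul_eq_zero_iff
    (mdifferentiable_thetaEven.mul mdifferentiable_thetaOdd) hd,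
    UpperHalfPlane.mul_eq_zero_iff mdifferentiable_thetaEven mdifferentiable_thetaOdd] at h
  rcases h with (h | h) | h
  · exact hne tendsto_thetaEven h
  · apply hne tendsto_thetaEven
    ext τ
    have h1 := thetaOdd_S_smul τ
    rw [h] at h1
    have h2 : (1 - Complex.I) / 2 ≠ 0 := by
      intro h; have := congrArg Complex.re h; norm_num at this
    have h3 := sqrt_ne_zero τ.ne_zero
    simpa [h2, h3, τ.ne_zero] using h1
  · exact hne tendsto_thetaEven_pow_sub h

/-- The parameter `e ^ (-π y / 2)` at the cusps of `Γ(4)`. -/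
noncomputable def cuspDecay (τ : ℍ) : ℝ := Real.exp (-2 * Real.pi * τ.im / 4)

theorem isTheta_one_of_tendsto {f : ℍ → ℂ} {c : ℂ} (hc : c ≠ 0) (h : Tendsto f atImInfty (𝓝 c)) :
    f =Θ[atImInfty] (1 : ℍ → ℝ) :=
  ((isEquivalent_const_iff_tendsto hc).mpr h).isTheta.trans (isTheta_const_const hc one_ne_zero)

theorem isTheta_etaSix : etaSix =Θ[atImInfty] cuspDecay := by
  have h1 : (fun τ : ℍ => eulerProd (Function.Periodic.qParam 1 τ) ^ 6) =Θ[atImInfty]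
      (1 : ℍ → ℝ) := by
    have := (tendsto_eulerProd_qParam one_pos).pow 6
    simp only [Complex.ofReal_one, one_mul, one_pow] at this
    exact isTheta_one_of_tendsto one_ne_zero this
  have h2 : (fun τ : ℍ => Function.Periodic.qParam 24 (τ : ℂ) ^ 6) =Θ[atImInfty] cuspDecay := by
    refine IsTheta.of_norm_eventuallyEq (Eventually.of_forall fun τ => ?_)
    change ‖Function.Periodic.qParam 24 (τ : ℂ) ^ 6‖ = _
    rw [norm_pow, Function.Periodic.norm_qParam, ← Real.exp_nat_mul, cuspDecay]
    congr 1; push_cast; rw [coe_im]; ring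
  have h3 := h2.mul h1
  simp only [Pi.one_apply, mul_one] at h3
  refine (EventuallyEq.isTheta (Eventually.of_forall fun τ => ?_)).trans h3
  simp only [etaSix, eta_eq_eulerProd, mul_pow]

theorem periodic_comp_ofComplex_of_T_zpow {f : ℍ → ℂ} (per : ∀ τ, f (T ^ (4 : ℤ) • τ) = f τ) :
    Function.Periodic (f ∘ ofComplex) ((4 : ℝ) : ℂ) := by
  intro z
  rw [Function.comp_apply, Function.comp_apply]
  rcases le_or_gt z.im 0 with h | h
  · rw [ofComplex_apply_of_im_nonpos h, ofComplex_apply_of_im_nonpos (by simpa using h)]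
  · rw [← per (ofComplex z), ofComplex_apply_of_im_pos h, ofComplex_apply_of_im_pos (by simpa using h)]
    congr 1
    ext
    rw [modular_T_zpow_smul, coe_vadd]
    simp [add_comm]

theorem isBigO_cuspDecay {f : ℍ → ℂ} (hol : MDifferentiable 𝓘(ℂ) 𝓘(ℂ) f)
    (per : ∀ τ, f (T ^ (4 : ℤ) • τ) = f τ) (zero : IsZeroAtImInfty f) :
    f =O[atImInfty] cuspDecay :=
  zero.exp_decay_atImInfty four_pos (periodic_comp_ofComplex_of_T_zpow per) hol
    zero.isBoundedAtImInfty

theorem tendsto_valueAtInfty {f : ℍ → ℂ} (hol : MDifferentiable 𝓘(ℂ) 𝓘(ℂ) f)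
    (per : ∀ τ, f (T ^ (4 : ℤ) • τ) = f τ) (bdd : IsBoundedAtImInfty f) :
    Tendsto f atImInfty (𝓝 (valueAtInfty f)) := by
  have h := UpperHalfPlane.exp_decay_sub_atImInfty four_pos
    (periodic_comp_ofComplex_of_T_zpow per) hol bdd
  have h1 : Tendsto (fun τ : ℍ => Real.exp (-2 * Real.pi * τ.im / 4)) atImInfty (𝓝 0) := by
    refine Real.tendsto_exp_atBot.comp ?_
    refine Tendsto.atBot_div_const four_pos ?_
    exact tendsto_comap.const_mul_atTop_of_neg (by linarith [Real.pi_pos])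
  have := (h.trans_tendsto h1).add_const (valueAtInfty f)
  simpa using this

/-- Boundedness of the quotient at i∞: the product tends to 0 and is invariant under T⁴, so it is
O(e^{-πy/2}), which is the exact size of η⁶. Invariance under SL₂(ℤ) transports the bound to all
cusps. -/
theorem exists_thetaProd_eq : ∃ c : ℂ, c ≠ 0 ∧ ∀ τ, thetaProd τ = c * etaSix τ := by
  have hT : ∀ τ, (thetaProd / etaSix) (T • τ) = (thetaProd / etaSix) τ := fun τ => by
    simp only [Pi.div_apply, thetaProd_T_smul, etaSix_T_smul]
    rw [mul_div_mul_left _ _ Complex.I_ne_zero]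
  have hS : ∀ τ, (thetaProd / etaSix) (S • τ) = (thetaProd / etaSix) τ := fun τ => by
    simp only [Pi.div_apply, thetaProd_S_smul, etaSix_S_smul]
    rw [mul_div_mul_left _ _ (mul_ne_zero Complex.I_ne_zero (pow_ne_zero _ τ.ne_zero))]
  have inv : ∀ γ : SL(2, ℤ), ∀ τ, (thetaProd / etaSix) (γ • τ) = (thetaProd / etaSix) τ := by
    intro γ
    have h : γ ∈ Subgroup.closure {S, T} := by simp [SpecialLinearGroup.SL2Z_generators]
    induction h using Subgroup.closure_induction with
    | mem x hx =>
      rcases hx with rfl | rfl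
      · exact hS
      · exact hT
    | one => simp
    | mul x y _ _ hx hy => intro τ; rw [mul_smul, hx, hy]
    | inv x _ hx => intro τ; rw [← hx, smul_inv_smul]
  have bdd : IsBoundedAtImInfty (thetaProd / etaSix) := by
    have h0 : IsZeroAtImInfty thetaProd := by
      have := (tendsto_thetaEven.mul tendsto_thetaOdd).mul tendsto_thetaEven_pow_sub
      rw [mul_zero, zero_mul] at this
      exact this
    have h1 : thetaProd =O[atImInfty] cuspDecay := by
      refine isBigO_cuspDecay thetaProd_mem_modForms.1 (fun τ => ?_) h0
      rw [show (4 : ℤ) = 1 + 1 + 1 + 1 by norm_num]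
      simp only [zpow_add, zpow_one, mul_smul, thetaProd_T_smul]
      linear_combination (thetaProd τ) * Complex.I_pow_four
    have h2 := h1.trans isTheta_etaSix.isBigO_symm
    have h3 := h2.mul (isBigO_refl (fun τ => (etaSix τ)⁻¹) atImInfty)
    refine (h3.congr (fun τ => (div_eq_mul_inv _ _).symm)
      (fun τ => mul_inv_cancel₀ (etaSix_ne_zero τ))).trans ?_
    exact isBigO_const_const _ one_ne_zero _
  obtain ⟨c, hc⟩ := eq_const_of_gamma_four (G := thetaProd / etaSix)
    (thetaProd_mem_modForms.1.div mdifferentiable_etaSix etaSix_ne_zero)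
    (fun γ _ => inv γ) (fun α => by simpa only [inv α] using! bdd)
  have hc' : ∀ τ, thetaProd τ = c * etaSix τ := fun τ => by
    rw [← hc τ, Pi.div_apply, div_mul_cancel₀ _ (etaSix_ne_zero τ)]
  refine ⟨c, ?_, hc'⟩
  rintro rfl
  exact thetaProd_ne_zero (funext fun τ => by simpa using hc' τ)

theorem etaSix_mem_modForms : etaSix ∈ modForms (Gamma 4) 6 := by
  obtain ⟨c, hc, h⟩ := exists_thetaProd_eq
  convert (modForms (Gamma 4) 6).smul_mem c⁻¹ thetaProd_mem_modForms using 1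
  ext τ
  simp [h, hc]

theorem thetaOdd_ne_zero (τ : ℍ) : thetaOdd τ ≠ 0 := by
  obtain ⟨c, hc, h⟩ := exists_thetaProd_eq
  intro h0
  have := h τ
  simp [thetaProd, h0, hc, etaSix_ne_zero] at this

theorem thetaEven_sub_mul_ne_zero {a : ℂ} (ha : a ^ 4 = 1) (τ : ℍ) :
    thetaEven τ - a * thetaOdd τ ≠ 0 := by
  obtain ⟨c, hc, h⟩ := exists_thetaProd_eq
  intro h0
  rw [sub_eq_zero] at h0
  have := h τ
  simp [thetaProd, h0, hc, etaSix_ne_zero, mul_pow, ha] at this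

theorem isTheta_thetaOdd : thetaOdd =Θ[atImInfty] cuspDecay := by
  obtain ⟨c, hc, h⟩ := exists_thetaProd_eq
  have h1 := tendsto_thetaEven.mul tendsto_thetaEven_pow_sub
  rw [mul_one] at h1
  have h2 := (isTheta_etaSix.const_mul_left hc).div (isTheta_one_of_tendsto one_ne_zero h1)
  simp only [Pi.one_apply, div_one] at h2
  refine (EventuallyEq.isTheta (Eventually.of_forall fun τ => ?_)).trans h2
  change _ = c * etaSix τ / (thetaEven τ * (thetaEven τ ^ 4 - thetaOdd τ ^ 4))
  have h3 := h τ
  simp only [thetaProd, Pi.mul_apply, Pi.sub_apply, Pi.pow_apply] at h3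
  rw [← h3, eq_div_iff]
  · ring
  · intro h4
    have h5 : c * etaSix τ = thetaOdd τ * (thetaEven τ * (thetaEven τ ^ 4 - thetaOdd τ ^ 4)) := by
      rw [← h3]; ring
    rw [h4, mul_zero] at h5
    exact mul_ne_zero hc (etaSix_ne_zero τ) h5

/-! ### Expansions at the cusps -/

theorem mdifferentiable_comp_smul {f : ℍ → ℂ} (hf : MDifferentiable 𝓘(ℂ) 𝓘(ℂ) f) (α : SL(2, ℤ)) :
    MDifferentiable 𝓘(ℂ) 𝓘(ℂ) fun τ : ℍ => f (α • τ) :=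
  hf.comp (UpperHalfPlane.mdifferentiable_smul (g := (α : GL (Fin 2) ℝ)) (by simp))

theorem mdifferentiable_halfSlash {k : ℕ} {f : ℍ → ℂ} (hf : MDifferentiable 𝓘(ℂ) 𝓘(ℂ) f)
    (α : SL(2, ℤ)) : MDifferentiable 𝓘(ℂ) 𝓘(ℂ) (halfSlash k f α) :=
  (mdifferentiable_comp_smul hf α).div ((mdifferentiable_halfFactor α).pow k)
    fun τ => pow_ne_zero _ (halfFactor_ne_zero α τ)

theorem smul_of_mem_modForms {Γ : Subgroup SL(2, ℤ)} {k : ℕ} {f : ℍ → ℂ} (hf : f ∈ modForms Γ k)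
    {γ : SL(2, ℤ)} (hγ : γ ∈ Γ) (τ : ℍ) : f (γ • τ) = halfFactor γ τ ^ k * f τ := by
  have h := congrFun (hf.2.1 γ hγ) τ
  rw [halfSlash, div_eq_iff (pow_ne_zero _ (halfFactor_ne_zero γ τ))] at h
  rw [h, mul_comm]

theorem T_zpow_four_mem_gamma : T ^ (4 : ℤ) ∈ Gamma 4 := by
  rw [Gamma_mem, coe_T_zpow]
  simp
  rfl

theorem thetaSpace_T_zpow_four_smul {f : ℍ → ℂ} (hf : f ∈ thetaSpace) (τ : ℍ) :
    f (T ^ (4 : ℤ) • τ) = f τ := by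
  obtain ⟨a, b, rfl⟩ := mem_thetaSpace.mp hf
  have h : Complex.I ^ (4 : ℤ) = 1 := Complex.I_pow_four
  simp only [Pi.add_apply, Pi.smul_apply, thetaEven_T_zpow_smul, thetaOdd_T_zpow_smul, h, one_mul]

/-- All cusps are regular: the sign ambiguity of the cocycle is trivial here. O serves as a witness,
since O|α lies in `thetaSpace` and is 4-periodic, O transforms with the exact factor under Γ(4), and
O can be cancelled because it has no zeros. -/
theorem halfFactor_conj_T_zpow_four (α : SL(2, ℤ)) (τ : ℍ) :
    halfFactor (α * T ^ (4 : ℤ) * α⁻¹) (α • τ) * halfFactor α τ =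
      halfFactor α (T ^ (4 : ℤ) • τ) := by
  have hγ : α * T ^ (4 : ℤ) * α⁻¹ ∈ Gamma 4 := (Gamma_normal 4).conj_mem _ T_zpow_four_mem_gamma α
  have h := thetaSpace_T_zpow_four_smul (halfSlash_mem_thetaSpace α _ thetaOdd_mem_thetaSpace) τ
  have h1 : α • T ^ (4 : ℤ) • τ = (α * T ^ (4 : ℤ) * α⁻¹) • α • τ := by
    simp only [← mul_smul, inv_mul_cancel_right]
  simp only [halfSlash, h1, thetaOdd_smul hγ, pow_one] at h
  have h2 := thetaOdd_ne_zero (α • τ)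
  have h3 := halfFactor_ne_zero α τ
  have h4 := halfFactor_ne_zero α (T ^ (4 : ℤ) • τ)
  field_simp at h
  exact h

theorem halfSlash_T_zpow_four_smul {k : ℕ} {f : ℍ → ℂ} (hf : f ∈ modForms (Gamma 4) k)
    (α : SL(2, ℤ)) (τ : ℍ) : halfSlash k f α (T ^ (4 : ℤ) • τ) = halfSlash k f α τ := by
  have hγ : α * T ^ (4 : ℤ) * α⁻¹ ∈ Gamma 4 := (Gamma_normal 4).conj_mem _ T_zpow_four_mem_gamma α
  have h1 : α • T ^ (4 : ℤ) • τ = (α * T ^ (4 : ℤ) * α⁻¹) • α • τ := by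
    simp only [← mul_smul, inv_mul_cancel_right]
  have h2 := halfFactor_conj_T_zpow_four α τ
  rw [halfSlash, h1, smul_of_mem_modForms hf hγ, ← h2, mul_pow, halfSlash]
  exact mul_div_mul_left _ _ (pow_ne_zero _ (halfFactor_ne_zero _ _))

theorem isBigO_halfSlash_cuspDecay {k : ℕ} {f : ℍ → ℂ} (hf : f ∈ modForms (Gamma 4) k)
    {α : SL(2, ℤ)} (h : IsZeroAtImInfty (halfSlash k f α)) :
    halfSlash k f α =O[atImInfty] cuspDecay :=
  isBigO_cuspDecay (mdifferentiable_halfSlash hf.1 α) (halfSlash_T_zpow_four_smul hf α) h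

/-- Division of modular forms. -/
theorem div_mem_modForms {Γ : Subgroup SL(2, ℤ)} {j k : ℕ} {f g : ℍ → ℂ}
    (hf : f ∈ modForms Γ (j + k)) (hg : g ∈ modForms Γ j) (hg0 : ∀ τ, g τ ≠ 0)
    (h : ∀ α, halfSlash (j + k) f α =O[atImInfty] halfSlash j g α) : f / g ∈ modForms Γ k := by
  have e : ∀ α, halfSlash k (f / g) α = halfSlash (j + k) f α / halfSlash j g α := by
    intro α
    ext τ
    have := halfFactor_ne_zero α τ
    have := hg0 (α • τ)
    simp only [halfSlash, Pi.div_apply, pow_add]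
    field_simp
  refine ⟨hf.1.div hg.1 hg0, fun γ hγ => ?_, fun α => ?_⟩
  · rw [e, hf.2.1 γ hγ, hg.2.1 γ hγ]
  · rw [e]
    have hne : ∀ τ, halfSlash j g α τ ≠ 0 := fun τ =>
      div_ne_zero (hg0 _) (pow_ne_zero _ (halfFactor_ne_zero _ _))
    have h3 := (h α).mul (isBigO_refl (fun τ => (halfSlash j g α τ)⁻¹) atImInfty)
    refine (h3.congr (fun τ => (div_eq_mul_inv _ _).symm)
      (fun τ => mul_inv_cancel₀ (hne τ))).trans ?_
    exact isBigO_const_const _ one_ne_zero _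

theorem norm_halfFactor_neg (α : SL(2, ℤ)) (τ : ℍ) : ‖halfFactor (-α) τ‖ = ‖halfFactor α τ‖ := by
  have h1 := congrArg norm (halfFactor_sq (-α) τ)
  have h2 := congrArg norm (halfFactor_sq α τ)
  rw [norm_pow] at h1 h2
  refine (pow_left_inj₀ (norm_nonneg _) (norm_nonneg _) two_ne_zero).mp ?_
  rw [h1, h2, ← norm_neg]
  congr 1
  simp [Matrix.SpecialLinearGroup.coe_neg]
  ring

theorem norm_halfSlash_neg (k : ℕ) (f : ℍ → ℂ) (α : SL(2, ℤ)) (τ : ℍ) :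
    ‖halfSlash k f (-α) τ‖ = ‖halfSlash k f α τ‖ := by
  simp only [halfSlash, norm_div, norm_pow, norm_halfFactor_neg, ModularGroup.SL_neg_smul]

theorem norm_eq_one_of_sq_eq_one {ε : ℂ} (h : ε ^ 2 = 1) : ‖ε‖ = 1 := by
  have := congrArg norm h
  rw [norm_pow, norm_one] at this
  exact (pow_eq_one_iff_of_nonneg (norm_nonneg _) two_ne_zero).mp this

/-- Growth at a cusp depends only on norms, so the signs of the cocycle and of -1 may be ignored
when passing to cusp representatives. -/
theorem norm_halfSlash_of_eq {Γ : Subgroup SL(2, ℤ)} {k : ℕ} {f : ℍ → ℂ} (hf : f ∈ modForms Γ k)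
    {α β γ : SL(2, ℤ)} (hγ : γ ∈ Γ) (h : α = γ * β ∨ α = -(γ * β)) (τ : ℍ) :
    ‖halfSlash k f α τ‖ = ‖halfSlash k f β τ‖ := by
  have key : ‖halfSlash k f (γ * β) τ‖ = ‖halfSlash k f β τ‖ := by
    obtain ⟨ε, hε, h⟩ := halfSlash_mul_group k γ β
    rw [h, hf.2.1 γ hγ, Pi.smul_apply, norm_smul, norm_eq_one_of_sq_eq_one hε, one_mul]
  rcases h with rfl | rfl
  · exact key
  · rw [norm_halfSlash_neg, key]

/-! ### Representatives of the cusps -/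

theorem mem_gamma_four {γ : SL(2, ℤ)} (ha : 4 ∣ γ 0 0 - 1) (hb : 4 ∣ γ 0 1) (hc : 4 ∣ γ 1 0)
    (hd : 4 ∣ γ 1 1 - 1) : γ ∈ Gamma 4 := by
  rw [Gamma_mem]
  refine ⟨?_, (ZMod.intCast_zmod_eq_zero_iff_dvd _ 4).mpr hb,
    (ZMod.intCast_zmod_eq_zero_iff_dvd _ 4).mpr hc, ?_⟩
  · have := (ZMod.intCast_zmod_eq_zero_iff_dvd _ 4).mpr ha
    push_cast at this
    exact sub_eq_zero.mp this
  · have := (ZMod.intCast_zmod_eq_zero_iff_dvd _ 4).mpr hd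
    push_cast at this
    exact sub_eq_zero.mp this

theorem exists_gamma_four_mul_T_zpow_of_mod {δ : SL(2, ℤ)} (hc : 4 ∣ δ 1 0) (hd : δ 1 1 % 4 = 1) :
    ∃ γ ∈ Gamma 4, ∃ i : ℤ, δ = γ * T ^ i := by
  -- The determinant gives a ≡ 1 mod 4, and this translation turns the upper right entry into b(1 -
  -- a²), a multiple of 4.
  refine ⟨δ * T ^ (-(δ 0 0 * δ 0 1)), ?_, δ 0 0 * δ 0 1, by
    rw [mul_assoc, ← zpow_add, neg_add_cancel, zpow_zero, mul_one]⟩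
  have hdet := δ.det_coe
  rw [Matrix.det_fin_two] at hdet
  have h1 : (δ * T ^ (-(δ 0 0 * δ 0 1))) 0 0 = δ 0 0 := by
    simp [Matrix.SpecialLinearGroup.coe_mul, coe_T_zpow, Matrix.mul_apply]
  have h2 : (δ * T ^ (-(δ 0 0 * δ 0 1))) 0 1 = δ 0 1 - δ 0 0 * δ 0 0 * δ 0 1 := by
    simp [Matrix.SpecialLinearGroup.coe_mul, coe_T_zpow, Matrix.mul_apply]
    ring
  have h3 := mul_T_zpow_lower_left δ (-(δ 0 0 * δ 0 1))
  have h4 := mul_T_zpow_lower_right δ (-(δ 0 0 * δ 0 1))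
  obtain ⟨c, hc⟩ := hc
  obtain ⟨d, hd⟩ : ∃ d, δ 1 1 = 4 * d + 1 := ⟨δ 1 1 / 4, by omega⟩
  rw [hc, hd] at hdet
  have ha : 4 ∣ δ 0 0 - 1 := ⟨δ 0 1 * c - δ 0 0 * d, by linarith⟩
  apply mem_gamma_four
  · rwa [h1]
  · rw [h2]
    obtain ⟨a, ha⟩ := ha
    exact ⟨-(a * (δ 0 0 + 1) * δ 0 1), by linear_combination (-(δ 0 0 + 1) * δ 0 1) * ha⟩
  · rw [h3, hc]; exact Dvd.intro _ rfl
  · rw [h4, hc, hd]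
    exact ⟨-(δ 0 0 * δ 0 1) * c + d, by ring⟩

theorem exists_gamma_four_mul_T_zpow {δ : SL(2, ℤ)} (hc : 4 ∣ δ 1 0) :
    ∃ γ ∈ Gamma 4, ∃ i : ℤ, δ = γ * T ^ i ∨ δ = -(γ * T ^ i) := by
  have hodd : δ 1 1 % 4 = 1 ∨ (-δ 1 1) % 4 = 1 := by
    have : δ 1 1 % 2 = 1 := by
      by_contra h
      have h2 := (isCoprime_lower_row δ).isUnit_of_dvd' (x := 2) (by omega) (by omega)
      norm_num [Int.isUnit_iff] at h2
    omega
  rcases hodd with h | h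
  · obtain ⟨γ, hγ, i, h⟩ := exists_gamma_four_mul_T_zpow_of_mod hc h
    exact ⟨γ, hγ, i, Or.inl h⟩
  · have hc' : 4 ∣ (-δ) 1 0 := by simpa [Matrix.SpecialLinearGroup.coe_neg] using hc
    have hd' : (-δ) 1 1 % 4 = 1 := by simpa [Matrix.SpecialLinearGroup.coe_neg] using h
    obtain ⟨γ, hγ, i, h⟩ := exists_gamma_four_mul_T_zpow_of_mod hc' hd'
    exact ⟨γ, hγ, i, Or.inr (by rw [← h, neg_neg])⟩

theorem mul_S_inv_lower_left (γ : SL(2, ℤ)) : (γ * S⁻¹) 1 0 = -γ 1 1 := by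
  rw [show S⁻¹ = -S by decide]
  simp [Matrix.SpecialLinearGroup.coe_mul, Matrix.SpecialLinearGroup.coe_neg, coe_S, Matrix.mul_apply]

theorem mul_S_inv_lower_right (γ : SL(2, ℤ)) : (γ * S⁻¹) 1 1 = γ 1 0 := by
  rw [show S⁻¹ = -S by decide]
  simp [Matrix.SpecialLinearGroup.coe_mul, Matrix.SpecialLinearGroup.coe_neg, coe_S, Matrix.mul_apply]

/-- Representatives for `SL₂(ℤ)` modulo `Γ(4)` on the left and translations. -/
theorem exists_cusp_representative (α : SL(2, ℤ)) :
    ∃ γ ∈ Gamma 4, ∃ β, (α = γ * β ∨ α = -(γ * β)) ∧ ∃ i : ℤ,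
      β = T ^ i ∨ (∃ j : ℤ, β = T ^ i * S * T ^ j) ∨ β = T ^ i * S * T ^ (2 : ℤ) * S := by
  have hcop : ¬ (2 ∣ α 1 0 ∧ 2 ∣ α 1 1) := by
    rintro ⟨h1, h2⟩
    have h2 := (isCoprime_lower_row α).isUnit_of_dvd' h1 h2
    norm_num [Int.isUnit_iff] at h2
  by_cases h4 : 4 ∣ α 1 0
  · obtain ⟨γ, hγ, i, h⟩ := exists_gamma_four_mul_T_zpow h4
    exact ⟨γ, hγ, T ^ i, h, i, Or.inl rfl⟩
  by_cases h2 : 2 ∣ α 1 0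
  · have hc : 4 ∣ (α * S⁻¹ * T ^ (-2 : ℤ) * S⁻¹) 1 0 := by
      rw [mul_S_inv_lower_left, mul_T_zpow_lower_right, mul_S_inv_lower_left, mul_S_inv_lower_right]
      omega
    obtain ⟨γ, hγ, i, h⟩ := exists_gamma_four_mul_T_zpow hc
    refine ⟨γ, hγ, T ^ i * S * T ^ (2 : ℤ) * S, ?_, i, Or.inr (Or.inr rfl)⟩
    have e : α = α * S⁻¹ * T ^ (-2 : ℤ) * S⁻¹ * (S * T ^ (2 : ℤ) * S) := by group
    rcases h with h | h
    · left; rw [e, h]; group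
    · right; rw [e, h, neg_mul]; group
  · obtain ⟨n, hc⟩ : ∃ n : ℤ, 4 ∣ (α * T ^ (-n) * S⁻¹) 1 0 := by
      -- With n = cd the new lower left entry is (c² - 1)d, a multiple of 4 for odd c.
      refine ⟨α 1 0 * α 1 1, ?_⟩
      rw [mul_S_inv_lower_left, mul_T_zpow_lower_right]
      obtain ⟨m, hm⟩ : ∃ m, α 1 0 = 2 * m + 1 := ⟨α 1 0 / 2, by omega⟩
      rw [hm]
      exact ⟨(m * m + m) * α 1 1, by ring⟩
    obtain ⟨γ, hγ, i, h⟩ := exists_gamma_four_mul_T_zpow hc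
    refine ⟨γ, hγ, T ^ i * S * T ^ n, ?_, i, Or.inr (Or.inl ⟨_, rfl⟩)⟩
    have e : α = α * T ^ (-n) * S⁻¹ * (S * T ^ n) := by group
    rcases h with h | h
    · left; rw [e, h]; group
    · right; rw [e, h, neg_mul]; group

/-! ### Generators of the ring of modular forms -/

theorem one_sub_I_div_two_ne_zero : (1 - Complex.I) / 2 ≠ 0 := by
  intro h; have := congrArg Complex.re h; norm_num at this

theorem ne_zero_of_sq_eq_one {ε : ℂ} (h : ε ^ 2 = 1) : ε ≠ 0 := by
  rintro rfl; norm_num at h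

/-- The coefficient a ≠ 0 is the value of O at this cusp. The explicit b is needed for j = 2, where
the form becomes a(E + O) and a further S maps it to a multiple of E. -/
theorem halfSlash_thetaOdd_T_S_T (i j : ℤ) : ∃ a b : ℂ, a ≠ 0 ∧
    halfSlash 1 thetaOdd (T ^ i * S * T ^ j) = a • thetaEven + (a * b) • thetaOdd ∧
      b = -Complex.I ^ j := by
  obtain ⟨ε, hε, h⟩ := halfSlash_mul_group 1 (T ^ i * S) (T ^ j)
  obtain ⟨δ, hδ, h'⟩ := halfSlash_mul_group 1 (T ^ i) S
  have e : halfSlash 1 thetaOdd (T ^ i) = Complex.I ^ i • thetaOdd := by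
    ext τ; rw [halfSlash_T_zpow, thetaOdd_T_zpow_smul]; rfl
  refine ⟨ε * (δ * (Complex.I ^ i * ((1 - Complex.I) / 2))), _, ?_, ?_, rfl⟩
  · have := zpow_ne_zero i Complex.I_ne_zero
    have := one_sub_I_div_two_ne_zero
    have := ne_zero_of_sq_eq_one hε
    have := ne_zero_of_sq_eq_one hδ
    positivity
  · rw [h, h', e, halfSlash_smul, halfSlash_smul, halfSlash_thetaOdd_S]
    ext τ
    rw [Pi.smul_apply, Pi.smul_apply, halfSlash_T_zpow]
    simp only [Pi.smul_apply, Pi.sub_apply, Pi.add_apply, smul_eq_mul, thetaEven_T_zpow_smul,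
      thetaOdd_T_zpow_smul]
    ring

theorem halfSlash_thetaOdd_T_S_T_S (i : ℤ) : ∃ a : ℂ, a ≠ 0 ∧
    halfSlash 1 thetaOdd (T ^ i * S * T ^ (2 : ℤ) * S) = a • thetaEven := by
  obtain ⟨ε, hε, h⟩ := halfSlash_mul_group 1 (T ^ i * S * T ^ (2 : ℤ)) S
  obtain ⟨a, b, ha, h', rfl⟩ := halfSlash_thetaOdd_T_S_T i 2
  refine ⟨ε * (a * (1 - Complex.I)), ?_, ?_⟩
  · have h1 : 1 - Complex.I ≠ 0 := fun h => one_sub_I_div_two_ne_zero (by rw [h, zero_div])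
    exact mul_ne_zero (ne_zero_of_sq_eq_one hε) (mul_ne_zero ha h1)
  · have hI : -Complex.I ^ (2 : ℤ) = 1 := by
      have : Complex.I ^ (2 : ℤ) = -1 := Complex.I_sq
      rw [this, neg_neg]
    rw [h, h', hI, mul_one, halfSlash_add, halfSlash_smul, halfSlash_smul, halfSlash_thetaEven_S,
      halfSlash_thetaOdd_S]
    ext τ
    simp only [Pi.smul_apply, Pi.sub_apply, Pi.add_apply, smul_eq_mul]
    ring

theorem tendsto_T_zpow_smul (i : ℤ) : Tendsto (fun τ : ℍ => T ^ i • τ) atImInfty atImInfty :=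
  UpperHalfPlane.tendsto_smul_atImInfty (g := ((T ^ i : SL(2, ℤ)) : GL (Fin 2) ℝ)) (by
    change (((T ^ i) 1 0 : ℤ) : ℝ) = 0
    rw [coe_T_zpow]
    simp)

/-- A form vanishing at `i∞` is divisible by `θ(τ/4) - θ(τ)`. -/
theorem div_thetaOdd_mem_modForms {k : ℕ} {f : ℍ → ℂ} (hf : f ∈ modForms (Gamma 4) (1 + k))
    (h0 : IsZeroAtImInfty f) : f / thetaOdd ∈ modForms (Gamma 4) k := by
  refine div_mem_modForms hf thetaOdd_mem_modForms thetaOdd_ne_zero fun α => ?_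
  obtain ⟨γ, hγ, β, hα, i, hβ⟩ := exists_cusp_representative α
  have h1 : ∀ τ, ‖halfSlash (1 + k) f α τ‖ = ‖halfSlash (1 + k) f β τ‖ :=
    norm_halfSlash_of_eq hf hγ hα
  have h2 : ∀ τ, ‖halfSlash 1 thetaOdd α τ‖ = ‖halfSlash 1 thetaOdd β τ‖ :=
    norm_halfSlash_of_eq thetaOdd_mem_modForms hγ hα
  suffices halfSlash (1 + k) f β =O[atImInfty] halfSlash 1 thetaOdd β by
    rw [← isBigO_norm_norm] at this ⊢
    simpa only [h1, h2] using this
  have unit : ∀ a b : ℂ, a ≠ 0 → halfSlash 1 thetaOdd β = a • thetaEven + b • thetaOdd →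
      halfSlash (1 + k) f β =O[atImInfty] halfSlash 1 thetaOdd β := by
    intro a b ha hab
    have h3 : halfSlash (1 + k) f β =O[atImInfty] (1 : ℍ → ℝ) := hf.2.2 β
    refine h3.trans ?_
    rw [hab]
    exact (isTheta_one_of_tendsto ha (tendsto_linear_combination_theta a b)).isBigO_symm
  -- At translates of i∞, f decays at least as fast as O. At the other cusps O has a nonzero limit,
  -- and boundedness of f is enough.
  rcases hβ with rfl | ⟨j, rfl⟩ | rfl
  · have hT := tendsto_T_zpow_smul i
    have hO : f =O[atImInfty] thetaOdd := by
      have h3 : IsZeroAtImInfty (halfSlash (1 + k) f 1) := by rwa [halfSlash_one_group]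
      have h4 := isBigO_halfSlash_cuspDecay hf h3
      rw [halfSlash_one_group] at h4
      exact h4.trans isTheta_thetaOdd.isBigO_symm
    refine (hO.comp_tendsto hT).congr (fun τ => ?_) (fun τ => ?_)
    · rw [halfSlash_T_zpow]; rfl
    · rw [halfSlash_T_zpow]; rfl
  · obtain ⟨a, b, ha, h, -⟩ := halfSlash_thetaOdd_T_S_T i j
    exact unit _ _ ha h
  · obtain ⟨a, ha, h⟩ := halfSlash_thetaOdd_T_S_T_S i
    exact unit a 0 ha (by rw [h, zero_smul, add_zero])

theorem exists_tendsto_atImInfty {k : ℕ} {f : ℍ → ℂ} (hf : f ∈ modForms (Gamma 4) k) :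
    ∃ c, Tendsto f atImInfty (𝓝 c) := by
  have h := halfSlash_T_zpow_four_smul hf 1
  have h' := hf.2.2 1
  rw [halfSlash_one_group] at h h'
  exact ⟨_, tendsto_valueAtInfty hf.1 h h'⟩

theorem form_congr {Γ : Subgroup SL(2, ℤ)} {j k : ℕ} {f g : ℍ → ℂ} (hf : f ∈ modForms Γ j)
    (hg : g ∈ modForms Γ k) (hjk : j = k) (hfg : f = g) : ModRing.form hf = ModRing.form hg := by
  subst hjk; subst hfg; rfl

theorem form_mul_form {Γ : Subgroup SL(2, ℤ)} {j k : ℕ} {f g : ℍ → ℂ} (hf : f ∈ modForms Γ j)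
    (hg : g ∈ modForms Γ k) :
    ModRing.form hf * ModRing.form hg = ModRing.form (SetLike.mul_mem_graded hf hg) :=
  DirectSum.of_mul_of _ _

theorem form_pow {Γ : Subgroup SL(2, ℤ)} {j : ℕ} {f : ℍ → ℂ} (hf : f ∈ modForms Γ j) (n : ℕ) :
    ModRing.form hf ^ n = ModRing.form (SetLike.pow_mem_graded n hf) :=
  DirectSum.ofPow (A := fun k : ℕ => modForms Γ k) ⟨f, hf⟩ n

theorem form_add {Γ : Subgroup SL(2, ℤ)} {j : ℕ} {f g : ℍ → ℂ} (hf : f ∈ modForms Γ j)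
    (hg : g ∈ modForms Γ j) :
    ModRing.form hf + ModRing.form hg = ModRing.form (Submodule.add_mem _ hf hg) :=
  (map_add (DirectSum.of (fun k : ℕ => modForms Γ k) j) ⟨f, hf⟩ ⟨g, hg⟩).symm

theorem smul_form {Γ : Subgroup SL(2, ℤ)} {j : ℕ} {f : ℍ → ℂ} (c : ℂ) (hf : f ∈ modForms Γ j) :
    c • ModRing.form hf = ModRing.form (Submodule.smul_mem _ c hf) :=
  (map_smul (DirectSum.lof ℂ ℕ (fun k : ℕ => modForms Γ k) j) c ⟨f, hf⟩).symm

theorem algebraMap_eq_form {Γ : Subgroup SL(2, ℤ)} (c : ℂ) (h : (fun _ => c) ∈ modForms Γ 0) :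
    algebraMap ℂ (ModRing Γ) c = ModRing.form h := by
  rw [DirectSum.algebraMap_apply]
  rfl

theorem const_of_mem_modForms_zero {f : ℍ → ℂ} (hf : f ∈ modForms (Gamma 4) 0) :
    ∃ c, ∀ τ, f τ = c :=
  eq_const_of_gamma_four hf.1 (fun γ hγ τ => by simpa using smul_of_mem_modForms hf hγ τ)
    (fun α => by
      convert hf.2.2 α using 1
      ext τ
      simp [halfSlash])

/-- Induction on the weight: f - cE^{k+1} vanishes at i∞ for c the limit of f, and its quotient by O
is a form of weight k/2. -/
theorem form_mem_adjoin_theta (k : ℕ) {f : ℍ → ℂ} (hf : f ∈ modForms (Gamma 4) k) :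
    ModRing.form hf ∈ Algebra.adjoin ℂ
      {ModRing.form thetaEven_mem_modForms, ModRing.form thetaOdd_mem_modForms} := by
  set A := Algebra.adjoin ℂ
    {ModRing.form thetaEven_mem_modForms, ModRing.form thetaOdd_mem_modForms} with hA
  have hX : ModRing.form thetaEven_mem_modForms ∈ A := Algebra.subset_adjoin (by simp)
  have hY : ModRing.form thetaOdd_mem_modForms ∈ A := Algebra.subset_adjoin (by simp)
  induction k generalizing f with
  | zero =>
    obtain ⟨c, hc⟩ := const_of_mem_modForms_zero hf
    obtain rfl : f = fun _ => c := funext hc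
    rw [← algebraMap_eq_form]
    exact A.algebraMap_mem c
  | succ k ih =>
    obtain ⟨c, hc⟩ := exists_tendsto_atImInfty hf
    have hE : thetaEven ^ (k + 1) ∈ modForms (Gamma 4) (k + 1) := by
      simpa using SetLike.pow_mem_graded (k + 1) thetaEven_mem_modForms
    have hg : f + (-c) • thetaEven ^ (k + 1) ∈ modForms (Gamma 4) (1 + k) := by
      rw [add_comm 1 k]
      exact Submodule.add_mem _ hf (Submodule.smul_mem _ _ hE)
    have h0 : IsZeroAtImInfty (f + (-c) • thetaEven ^ (k + 1)) := by
      have := hc.add ((tendsto_thetaEven.pow (k + 1)).const_mul (-c))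
      rw [one_pow, mul_one, add_neg_cancel] at this
      exact this
    have hq := div_thetaOdd_mem_modForms hg h0
    have e : ModRing.form hf = ModRing.form thetaOdd_mem_modForms * ModRing.form hq +
        c • ModRing.form thetaEven_mem_modForms ^ (k + 1) := by
      rw [form_mul_form, form_pow, smul_form,
        form_congr (SetLike.mul_mem_graded thetaOdd_mem_modForms hq)
          (Submodule.add_mem _ hf (Submodule.smul_mem _ (-c) hE)) (add_comm 1 k) ?_,
        form_congr (Submodule.smul_mem _ c (SetLike.pow_mem_graded (k + 1) thetaEven_mem_modForms))
          (Submodule.smul_mem _ c hE) (by simp) rfl, form_add]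
      · refine form_congr _ _ rfl ?_
        ext τ; simp
      · ext τ
        simp only [Pi.mul_apply, Pi.div_apply]
        rw [mul_div_cancel₀ _ (thetaOdd_ne_zero τ)]
    rw [e]
    exact A.add_mem (A.mul_mem hY (ih hq)) (A.smul_mem (A.pow_mem hX _) _)

theorem adjoin_theta_eq_top : Algebra.adjoin ℂ
    {ModRing.form thetaEven_mem_modForms, ModRing.form thetaOdd_mem_modForms} =
      (⊤ : Subalgebra ℂ (ModRing (Gamma 4))) := by
  rw [eq_top_iff]
  intro F _
  induction F using DirectSum.induction_on with
  | zero => exact Subalgebra.zero_mem _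
  | of k f => exact form_mem_adjoin_theta k f.2
  | add F G hF hG => exact Subalgebra.add_mem _ (hF trivial) (hG trivial)

/-! ### Algebraic independence -/

/-- The evaluation `∑ f_k ↦ ∑ f_k(τ) μ ^ k` of the graded ring at a point of the upper half-plane. -/
noncomputable def evalHom (Γ : Subgroup SL(2, ℤ)) (τ : ℍ) (μ : ℂ) : ModRing Γ →ₐ[ℂ] ℂ :=
  DirectSum.toAlgebra ℂ (fun k : ℕ => modForms Γ k)
    (fun k => μ ^ k • (LinearMap.proj τ).comp (modForms Γ k).subtype)
    (by
      change μ ^ 0 • (1 : ℂ) = 1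
      simp)
    (by
      intro i j f g
      change μ ^ (i + j) • ((f : ℍ → ℂ) τ * (g : ℍ → ℂ) τ) =
        (μ ^ i • (f : ℍ → ℂ) τ) * (μ ^ j • (g : ℍ → ℂ) τ)
      simp only [smul_eq_mul, pow_add]
      ring)

theorem evalHom_form {Γ : Subgroup SL(2, ℤ)} {k : ℕ} {f : ℍ → ℂ} (hf : f ∈ modForms Γ k) (τ : ℍ)
    (μ : ℂ) : evalHom Γ τ μ (ModRing.form hf) = μ ^ k * f τ := by
  exact DirectSum.toAddMonoid_of (β := fun k : ℕ => modForms Γ k)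
    (fun k => (μ ^ k • (LinearMap.proj τ).comp (modForms Γ k).subtype).toAddMonoidHom) k ⟨f, hf⟩

/-- A relation F(p, q) = 0 is evaluated at all points τ with an extra scaling μ, giving F(μ, μr(τ))
= 0 for r = q/p. By connectedness of ℍ a non-constant r has infinite range, which forces F = 0. -/
theorem algebraicIndependent_form_pair {Γ : Subgroup SL(2, ℤ)} {p q : ℍ → ℂ}
    (hp : p ∈ modForms Γ 1) (hq : q ∈ modForms Γ 1) (hp0 : ∀ τ, p τ ≠ 0) {l : ℂ}
    (hl : Tendsto (fun τ => q τ / p τ) atImInfty (𝓝 l)) (hne : ∃ τ, q τ / p τ ≠ l) :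
    AlgebraicIndependent ℂ ![ModRing.form hp, ModRing.form hq] := by
  set r : ℍ → ℂ := fun τ => q τ / p τ with hr
  have hcont : Continuous r := hq.1.continuous.div hp.1.continuous hp0
  have hinf : (Set.range r).Infinite := by
    refine (isPreconnected_range hcont).infinite_of_nontrivial ?_
    by_contra hs
    rw [Set.not_nontrivial_iff] at hs
    obtain ⟨τ₀, h0⟩ := hne
    apply h0
    refine tendsto_nhds_unique ?_ hl
    exact tendsto_const_nhds.congr fun τ => hs ⟨τ₀, rfl⟩ ⟨τ, rfl⟩
  rw [algebraicIndependent_iff]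
  intro F hF
  have h1 : ∀ τ μ, MvPolynomial.eval ![μ, μ * r τ] F = 0 := by
    intro τ μ
    -- The scaling μ/p(τ) sends the first generator to μ and the second to μr(τ).
    have h := congrArg (evalHom Γ τ (μ / p τ)) hF
    rw [map_zero, MvPolynomial.comp_aeval_apply] at h
    rw [← h, ← MvPolynomial.coe_aeval_eq_eval]
    change MvPolynomial.aeval _ F = _
    congr 2
    ext i
    have := hp0 τ
    fin_cases i <;> simp [evalHom_form, hr] <;> field_simp
  have h2 : MvPolynomial.bind₁ ![MvPolynomial.X 0, MvPolynomial.X 0 * MvPolynomial.X 1] F =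
      (0 : MvPolynomial (Fin 2) ℂ) := by
    refine MvPolynomial.funext_set ![Set.univ, Set.range r] ?_ ?_
    · intro i
      fin_cases i
      · exact Set.infinite_univ
      · exact hinf
    · intro x hx
      obtain ⟨τ, hτ⟩ := hx 1 trivial
      rw [map_zero, ← h1 τ (x 0), ← MvPolynomial.coe_aeval_eq_eval, ← MvPolynomial.coe_aeval_eq_eval]
      change MvPolynomial.aeval x (MvPolynomial.bind₁ _ F) = MvPolynomial.aeval _ F
      rw [MvPolynomial.aeval_bind₁]
      congr 2
      ext i
      fin_cases i <;> simp [hτ]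
  refine MvPolynomial.funext_set ![{0}ᶜ, Set.univ] ?_ ?_
  · intro i
    fin_cases i
    · exact (Set.finite_singleton 0).infinite_compl
    · exact Set.infinite_univ
  · intro x hx
    have hx0 : x 0 ≠ 0 := hx 0 trivial
    -- Every point with nonzero first coordinate has the form (X, XY), so F vanishes there.
    have h3 := congrArg (MvPolynomial.aeval ![x 0, x 1 / x 0]) h2
    rw [MvPolynomial.aeval_bind₁, map_zero] at h3
    rw [map_zero, ← h3, ← MvPolynomial.coe_aeval_eq_eval]
    change MvPolynomial.aeval _ F = _
    congr 2
    ext i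
    fin_cases i
    · simp
    · simp; field_simp

/-! ### Cusp forms -/

/-- The fourth power of η⁶ is the discriminant, which is invariant in weight 12 under SL₂(ℤ). -/
theorem norm_halfSlash_etaSix (α : SL(2, ℤ)) (τ : ℍ) : ‖halfSlash 6 etaSix α τ‖ = ‖etaSix τ‖ := by
  have h := congrFun (SlashInvariantForm.slash_action_generators_SL2Z
    ModularForm.discriminant_S_invariant ModularForm.discriminant_T_invariant α) τ
  rw [ModularForm.SL_slash_apply, ModularGroup.denom_apply] at h
  have e : ∀ τ, ModularForm.discriminant τ = etaSix τ ^ 4 := fun τ => by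
    rw [ModularForm.discriminant, etaSix, ← pow_mul]
  rw [e, e] at h
  have h2 : halfSlash 6 etaSix α τ ^ 4 = etaSix τ ^ 4 := by
    rw [← h, halfSlash, halfFactor_pow_two_mul α τ 3, div_pow, ← pow_mul, zpow_neg, div_eq_mul_inv]
    norm_cast
  have h3 := congrArg norm h2
  rw [norm_pow, norm_pow] at h3
  exact (pow_left_inj₀ (norm_nonneg _) (norm_nonneg _) four_ne_zero).mp h3

theorem isTheta_halfSlash_etaSix (α : SL(2, ℤ)) :
    halfSlash 6 etaSix α =Θ[atImInfty] cuspDecay := by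
  have := isTheta_etaSix
  rw [← isTheta_norm_left] at this ⊢
  simpa only [norm_halfSlash_etaSix] using this

theorem isZeroAtImInfty_etaSix : IsZeroAtImInfty etaSix := by
  have h1 : Tendsto cuspDecay atImInfty (𝓝 0) := by
    refine Real.tendsto_exp_atBot.comp ?_
    refine Tendsto.atBot_div_const four_pos ?_
    exact tendsto_comap.const_mul_atTop_of_neg (by linarith [Real.pi_pos])
  exact isTheta_etaSix.isBigO.trans_tendsto h1

theorem etaSix_mem_cuspForms : etaSix ∈ cuspForms (Gamma 4) 6 := by
  refine ⟨etaSix_mem_modForms.1, etaSix_mem_modForms.2.1, fun α => ?_⟩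
  exact ((isTheta_halfSlash_etaSix α).trans isTheta_etaSix.symm).isBigO.trans_tendsto
    isZeroAtImInfty_etaSix

theorem cuspForms_le_modForms (Γ : Subgroup SL(2, ℤ)) (k : ℕ) : cuspForms Γ k ≤ modForms Γ k :=
  fun _ hf => ⟨hf.1, hf.2.1, fun α => (hf.2.2 α).isBoundedAtImInfty⟩

theorem isZeroAtImInfty_of_mem_cuspForms {Γ : Subgroup SL(2, ℤ)} {k : ℕ} {f : ℍ → ℂ}
    (hf : f ∈ cuspForms Γ k) : IsZeroAtImInfty f := by
  simpa only [halfSlash_one_group] using hf.2.2 1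

/-- Cusp forms are divisible by `η ^ 6`. -/
theorem div_etaSix_mem_modForms {k : ℕ} {f : ℍ → ℂ} (hf : f ∈ cuspForms (Gamma 4) (6 + k)) :
    f / etaSix ∈ modForms (Gamma 4) k :=
  div_mem_modForms (cuspForms_le_modForms _ _ hf) etaSix_mem_modForms etaSix_ne_zero fun α =>
    (isBigO_halfSlash_cuspDecay (cuspForms_le_modForms _ _ hf) (hf.2.2 α)).trans
      (isTheta_halfSlash_etaSix α).isBigO_symm

/-- With n = 5 - k, the cusp form O^{n+1}f has weight 3 and so equals cη⁶. Cancelling one O leaves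
O^n f equal to a multiple of E(E⁴ - O⁴). The left side tends to 0 at i∞ while E(E⁴ - O⁴) tends to 1,
so the multiple is 0. -/
theorem eq_zero_of_mem_cuspForms {k : ℕ} (hk : k ≤ 5) {f : ℍ → ℂ}
    (hf : f ∈ cuspForms (Gamma 4) k) : f = 0 := by
  obtain ⟨n, hn⟩ := Nat.exists_eq_add_of_le hk
  have h1 : thetaOdd ^ (n + 1) ∈ modForms (Gamma 4) (n + 1) := by
    simpa using SetLike.pow_mem_graded (n + 1) thetaOdd_mem_modForms
  have h2 : thetaOdd ^ (n + 1) * f ∈ cuspForms (Gamma 4) (6 + 0) := by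
    rw [show 6 + 0 = n + 1 + k by omega]
    exact mul_mem_cuspForms h1 hf
  obtain ⟨c, hc⟩ := const_of_mem_modForms_zero (div_etaSix_mem_modForms h2)
  obtain ⟨d, hd, hP⟩ := exists_thetaProd_eq
  have h3 : ∀ τ, thetaOdd τ ^ n * f τ =
      c / d * (thetaEven τ * (thetaEven τ ^ 4 - thetaOdd τ ^ 4)) := by
    intro τ
    have h4 := hc τ
    rw [Pi.div_apply, div_eq_iff (etaSix_ne_zero τ), Pi.mul_apply, Pi.pow_apply] at h4
    have h5 := hP τ
    simp only [thetaProd, Pi.mul_apply, Pi.sub_apply, Pi.pow_apply] at h5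
    apply mul_left_cancel₀ (thetaOdd_ne_zero τ)
    field_simp
    linear_combination d * h4 + (-c) * h5
  have h6 : Tendsto (fun τ => thetaOdd τ ^ n * f τ) atImInfty (𝓝 0) := by
    have := (tendsto_thetaOdd.pow n).mul (isZeroAtImInfty_of_mem_cuspForms hf)
    rwa [mul_zero] at this
  have h7 := (tendsto_thetaEven.mul tendsto_thetaEven_pow_sub).const_mul (c / d)
  rw [mul_one, mul_one] at h7
  have h8 : c / d = 0 := tendsto_nhds_unique h7 (h6.congr h3)
  ext τ
  have h9 := h3 τ
  rw [h8, zero_mul] at h9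
  exact (mul_eq_zero.mp h9).resolve_left (pow_ne_zero _ (thetaOdd_ne_zero τ))

theorem cuspIdeal_eq_span : cuspIdeal (Gamma 4) = Ideal.span {ModRing.form etaSix_mem_modForms} := by
  classical
  apply le_antisymm
  · intro F hF
    rw [← DirectSum.sum_support_of F]
    refine Ideal.sum_mem _ fun k _ => ?_
    have hk : (F k : ℍ → ℂ) ∈ cuspForms (Gamma 4) k := hF k
    rcases Nat.lt_or_ge 5 k with h | h
    · obtain ⟨n, rfl⟩ := Nat.exists_eq_add_of_le (show 6 ≤ k from h)
      have hq := div_etaSix_mem_modForms hk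
      have e : DirectSum.of (fun k : ℕ => modForms (Gamma 4) k) (6 + n) (F (6 + n)) =
          ModRing.form etaSix_mem_modForms * ModRing.form hq := by
        rw [form_mul_form]
        refine form_congr (F (6 + n)).2 _ rfl ?_
        ext τ
        simp only [Pi.mul_apply, Pi.div_apply]
        rw [mul_div_cancel₀ _ (etaSix_ne_zero τ)]
      rw [e]
      exact Ideal.mul_mem_right _ _ (Ideal.subset_span rfl)
    · have e : F k = 0 := Subtype.ext (eq_zero_of_mem_cuspForms h hk)
      rw [e, map_zero]
      exact Ideal.zero_mem _
  · rw [Ideal.span_le, Set.singleton_subset_iff]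
    intro k
    rcases eq_or_ne k 6 with rfl | h
    · rw [ModRing.form, DirectSum.of_eq_same]
      exact etaSix_mem_cuspForms
    · rw [ModRing.form, DirectSum.of_eq_of_ne _ _ _ h]
      exact Submodule.zero_mem _

/-! ### Eta quotients -/

theorem multipliable_one_sub_pow_odd {q : ℂ} (hq : ‖q‖ < 1) :
    Multipliable fun n : ℕ => 1 - q ^ (2 * n + 1) := by
  have h1 : Summable fun n : ℕ => ‖-q ^ (2 * n + 1)‖ := by
    have hq2 : ‖q‖ ^ 2 < 1 := pow_lt_one₀ (norm_nonneg _) hq two_ne_zero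
    refine ((summable_geometric_of_lt_one (sq_nonneg ‖q‖) hq2).mul_left ‖q‖).congr fun n => ?_
    rw [norm_neg, norm_pow, pow_succ ‖q‖ (2 * n), pow_mul, mul_comm]
  simpa only [sub_eq_add_neg] using multipliable_one_add_of_summable h1

theorem eulerProd_eq_odd_mul {q : ℂ} (hq : ‖q‖ < 1) :
    eulerProd q = (∏' n : ℕ, (1 - q ^ (2 * n + 1))) * eulerProd (q ^ 2) := by
  have hq2 : ‖q ^ 2‖ < 1 := by
    rw [norm_pow]; exact pow_lt_one₀ (norm_nonneg _) hq two_ne_zero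
  have he : Multipliable fun n : ℕ => 1 - q ^ (2 * n + 1 + 1) := by
    refine (ModularForm.multipliable_one_sub_pow hq2).congr fun n => ?_
    rw [← pow_mul]; ring_nf
  rw [eulerProd, ← tprod_even_mul_odd (f := fun n => 1 - q ^ (n + 1))
    (multipliable_one_sub_pow_odd hq) he, eulerProd]
  congr 2
  ext n
  rw [← pow_mul]; ring_nf

/-- Replacing q by -q alters only the factors with odd exponent, and (1 - qᵐ)(1 + qᵐ) = 1 - q^{2m}
for odd m gives the odd part of the product at q². -/
theorem eulerProd_mul_eulerProd_neg {q : ℂ} (hq : ‖q‖ < 1) :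
    eulerProd q * eulerProd (-q) * eulerProd (q ^ 4) = eulerProd (q ^ 2) ^ 3 := by
  have hq' : ‖-q‖ < 1 := by rwa [norm_neg]
  have hq2 : ‖q ^ 2‖ < 1 := by
    rw [norm_pow]; exact pow_lt_one₀ (norm_nonneg _) hq two_ne_zero
  have h1 := eulerProd_eq_odd_mul hq
  have h2 := eulerProd_eq_odd_mul hq'
  have h3 := eulerProd_eq_odd_mul hq2
  have h4 : (∏' n : ℕ, (1 - q ^ (2 * n + 1))) * (∏' n : ℕ, (1 - (-q) ^ (2 * n + 1))) =
      ∏' n : ℕ, (1 - (q ^ 2) ^ (2 * n + 1)) := by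
    rw [← (multipliable_one_sub_pow_odd hq).tprod_mul (multipliable_one_sub_pow_odd hq')]
    refine tprod_congr fun n => ?_
    rw [Odd.neg_pow (odd_two_mul_add_one n), ← pow_mul]
    ring
  rw [neg_sq] at h2
  rw [← pow_mul] at h3
  rw [h1, h2]
  linear_combination (eulerProd (q ^ 2) ^ 2 * eulerProd (q ^ 4)) * h4 - eulerProd (q ^ 2) ^ 2 * h3

theorem eulerProd_qParam_ne_zero {z : ℂ} (hz : 0 < z.im) :
    eulerProd (Function.Periodic.qParam 1 z) ≠ 0 := ModularForm.eta_tprod_ne_zero hz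

theorem eta_add_half : ∃ C : ℂ, C ≠ 0 ∧ ∀ z : ℂ, 0 < z.im → ModularForm.eta (z + 1 / 2) =
    C * (ModularForm.eta (2 * z) ^ 3 / (ModularForm.eta z * ModularForm.eta (4 * z))) := by
  refine ⟨Complex.exp (2 * Real.pi * Complex.I / 48), Complex.exp_ne_zero _, fun z hz => ?_⟩
  have e1 : Function.Periodic.qParam 1 (z + 1 / 2) = -Function.Periodic.qParam 1 z := by
    simp only [Function.Periodic.qParam, Complex.ofReal_one, div_one]
    rw [mul_add, Complex.exp_add,
      show 2 * (Real.pi : ℂ) * Complex.I * (1 / 2) = Real.pi * Complex.I by ring,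
      Complex.exp_pi_mul_I, mul_neg_one]
  have e2 : Function.Periodic.qParam 1 (2 * z) = Function.Periodic.qParam 1 z ^ 2 := by
    simp only [Function.Periodic.qParam, ← Complex.exp_nat_mul]
    congr 1; push_cast; ring
  have e4 : Function.Periodic.qParam 1 (4 * z) = Function.Periodic.qParam 1 z ^ 4 := by
    simp only [Function.Periodic.qParam, ← Complex.exp_nat_mul]
    congr 1; push_cast; ring
  have f2 : Function.Periodic.qParam 24 (2 * z) = Function.Periodic.qParam 24 z ^ 2 := by
    simp only [Function.Periodic.qParam, ← Complex.exp_nat_mul]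
    congr 1; push_cast; ring
  have f4 : Function.Periodic.qParam 24 (4 * z) = Function.Periodic.qParam 24 z ^ 4 := by
    simp only [Function.Periodic.qParam, ← Complex.exp_nat_mul]
    congr 1; push_cast; ring
  have f1 : Function.Periodic.qParam 24 (z + 1 / 2) =
      Complex.exp (2 * Real.pi * Complex.I / 48) * Function.Periodic.qParam 24 z := by
    simp only [Function.Periodic.qParam, ← Complex.exp_add]
    congr 1; push_cast; ring
  have hE := eulerProd_mul_eulerProd_neg
    (by simpa using Function.Periodic.norm_qParam_lt_one one_pos hz :
      ‖Function.Periodic.qParam 1 z‖ < 1)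
  have hn1 := eulerProd_qParam_ne_zero hz
  have hn4 := eulerProd_qParam_ne_zero (z := 4 * z) (by simpa using hz)
  have hq := Function.Periodic.qParam_ne_zero (h := 24) z
  simp only [eta_eq_eulerProd, e1, e2, e4, f2, f4, f1]
  rw [e4] at hn4
  generalize Function.Periodic.qParam 24 z = Q at *
  generalize Complex.exp (2 * Real.pi * Complex.I / 48) = ζ at *
  field_simp
  rw [← hE]
  ring

/-- The function `η(rτ)`. -/
noncomputable def etaScaled (r : ℝ) (τ : ℍ) : ℂ := ModularForm.eta ((r : ℂ) * τ)

theorem etaScaled_ne_zero {r : ℝ} (hr : 0 < r) (τ : ℍ) : etaScaled r τ ≠ 0 := eta_ne_zero' τ hr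

theorem mdifferentiable_etaScaled {r : ℝ} (hr : 0 < r) :
    MDifferentiable 𝓘(ℂ) 𝓘(ℂ) (etaScaled r) := by
  apply mdifferentiable_of_differentiableOn (g := fun z => ModularForm.eta ((r : ℂ) * z))
  intro z hz
  refine DifferentiableAt.differentiableWithinAt ?_
  have : 0 < ((r : ℂ) * z).im := by simpa using mul_pos hr hz
  exact DifferentiableAt.comp (f := fun z : ℂ => (r : ℂ) * z) z
    (ModularForm.differentiableAt_eta_of_mem_upperHalfPlaneSet this) (by fun_prop)

/-- This reduces the order of an eta quotient at i∞ to adding the scalings r with multiplicity. -/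
theorem isTheta_etaScaled {r : ℝ} (hr : 0 < r) :
    etaScaled r =Θ[atImInfty] fun τ : ℍ => Real.exp (-2 * Real.pi * τ.im / 24) ^ r := by
  have h1 := isTheta_one_of_tendsto one_ne_zero (tendsto_eulerProd_qParam hr)
  have h2 : (fun τ : ℍ => Function.Periodic.qParam 24 ((r : ℂ) * τ)) =Θ[atImInfty]
      fun τ : ℍ => Real.exp (-2 * Real.pi * τ.im / 24) ^ r := by
    refine IsTheta.of_norm_eventuallyEq (Eventually.of_forall fun τ => ?_)
    change ‖Function.Periodic.qParam 24 ((r : ℂ) * τ)‖ =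
      Real.exp (-2 * Real.pi * τ.im / 24) ^ r
    rw [Function.Periodic.norm_qParam, ← Real.exp_mul]
    congr 1
    rw [Complex.im_ofReal_mul, coe_im]; ring
  have h3 := h2.mul h1
  simp only [Pi.one_apply, mul_one] at h3
  exact h3

theorem sqrt_real_mul {r : ℝ} (hr : 0 < r) (τ : ℍ) :
    ((r : ℂ) * τ) ^ (1 / 2 : ℂ) = (Real.sqrt r : ℂ) * (τ : ℂ) ^ (1 / 2 : ℂ) := by
  refine (eq_sqrt_of_sq ?_ ?_).symm
  · rw [mul_pow, sqrt_sq, ← Complex.ofReal_pow, Real.sq_sqrt hr.le]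
  · rw [Complex.re_ofReal_mul]
    exact mul_pos (Real.sqrt_pos.mpr hr) (sqrt_re_pos (Or.inr τ.im_ne_zero))

theorem etaScaled_S_smul {r s : ℝ} (hr : 0 < r) (hrs : r * s = 1) : ∃ C : ℂ, C ≠ 0 ∧ ∀ τ,
    etaScaled r (S • τ) = C * (τ : ℂ) ^ (1 / 2 : ℂ) * etaScaled s τ := by
  have hs : 0 < s := by
    by_contra! h; nlinarith
  refine ⟨(Complex.I ^ (1 / 2 : ℂ))⁻¹ * (Real.sqrt s : ℂ), ?_, fun τ => ?_⟩
  · refine mul_ne_zero (inv_ne_zero (sqrt_ne_zero Complex.I_ne_zero)) ?_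
    exact_mod_cast (Real.sqrt_pos.mpr hs).ne'
  · have e : (r : ℂ) * ((S • τ : ℍ) : ℂ) = -1 / ((s : ℂ) * τ) := by
      have h1 : (r : ℂ) * s = 1 := by exact_mod_cast hrs
      have h2 : (s : ℂ) ≠ 0 := by exact_mod_cast hs.ne'
      have h3 := τ.ne_zero
      have h4 : ((S • τ : ℍ) : ℂ) = -1 / (τ : ℂ) := by
        rw [modular_S_smul, neg_div, one_div, ← inv_neg]
      rw [h4]
      field_simp
      linear_combination -h1
    rw [etaScaled, e, eta_neg_inv (by simpa using mul_pos hs τ.im_pos), sqrt_real_mul hs, etaScaled]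
    ring

theorem etaScaled_T_zpow_smul {r : ℝ} {n m : ℤ} (h : r * n = m) (τ : ℍ) :
    etaScaled r (T ^ n • τ) = Complex.exp (2 * Real.pi * Complex.I / 24) ^ m * etaScaled r τ := by
  have key : ∀ z : ℂ, ModularForm.eta (z + m) =
      Complex.exp (2 * Real.pi * Complex.I / 24) ^ m * ModularForm.eta z := by
    have h0 := Complex.exp_ne_zero (2 * Real.pi * Complex.I / 24)
    clear h
    induction m with
    | zero => simp
    | succ m ih =>
      intro z
      push_cast at ih ⊢
      rw [← add_assoc, eta_add_one, ih, zpow_add₀ h0, zpow_one]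
      ring
    | pred m ih =>
      intro z
      have h1 := eta_add_one (z + (-m - 1 : ℂ))
      rw [show z + (-m - 1 : ℂ) + 1 = z + -m by ring] at h1
      push_cast at ih ⊢
      rw [ih] at h1
      rw [zpow_sub₀ h0, zpow_one]
      field_simp
      rw [mul_comm, ← h1]
  rw [etaScaled, modular_T_zpow_smul, coe_vadd, etaScaled, ← key]
  congr 1
  have h' : (r : ℂ) * n = m := by exact_mod_cast h
  push_cast
  linear_combination h'

/-- The function `η^♯(2τ) = η(4τ)² / η(2τ)`. -/
noncomputable def etaQuotSharp (τ : ℍ) : ℂ := etaScaled 4 τ ^ 2 / etaScaled 2 τ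

/-- The function `η^♭(τ/2) = η(τ/4)² / η(τ/2)`. -/
noncomputable def etaQuotFlat (τ : ℍ) : ℂ := etaScaled (1 / 4) τ ^ 2 / etaScaled (1 / 2) τ

theorem etaQuotSharp_ne_zero (τ : ℍ) : etaQuotSharp τ ≠ 0 :=
  div_ne_zero (pow_ne_zero _ (etaScaled_ne_zero four_pos τ)) (etaScaled_ne_zero two_pos τ)

theorem etaQuotFlat_ne_zero (τ : ℍ) : etaQuotFlat τ ≠ 0 :=
  div_ne_zero (pow_ne_zero _ (etaScaled_ne_zero (by norm_num) τ)) (etaScaled_ne_zero (by norm_num) τ)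

theorem etaQuotSharp_S_smul : ∃ C : ℂ, C ≠ 0 ∧ ∀ τ,
    etaQuotSharp (S • τ) = C * (τ : ℂ) ^ (1 / 2 : ℂ) * etaQuotFlat τ := by
  obtain ⟨C₄, h₄, H₄⟩ := etaScaled_S_smul (r := 4) (s := 1 / 4) (by norm_num) (by norm_num)
  obtain ⟨C₂, h₂, H₂⟩ := etaScaled_S_smul (r := 2) (s := 1 / 2) (by norm_num) (by norm_num)
  refine ⟨C₄ ^ 2 / C₂, by positivity, fun τ => ?_⟩
  have h0 := sqrt_ne_zero τ.ne_zero
  have h1 := etaScaled_ne_zero (r := 1 / 2) (by norm_num) τ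
  rw [etaQuotSharp, H₄, H₂, etaQuotFlat]
  field_simp

theorem etaQuotSharp_T_smul (τ : ℍ) : etaQuotSharp (T • τ) = Complex.I * etaQuotSharp τ := by
  have h4 := etaScaled_T_zpow_smul (r := 4) (n := 1) (m := 4) (by norm_num) τ
  have h2 := etaScaled_T_zpow_smul (r := 2) (n := 1) (m := 2) (by norm_num) τ
  rw [zpow_one] at h4 h2
  have hI : Complex.exp (2 * Real.pi * Complex.I / 24) ^ 6 = Complex.I := by
    rw [← Complex.exp_nat_mul]
    conv_rhs => rw [← Complex.exp_pi_div_two_mul_I]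
    congr 1; push_cast; ring
  have h0 := Complex.exp_ne_zero (2 * Real.pi * Complex.I / 24)
  have h1 := etaScaled_ne_zero two_pos τ
  generalize Complex.exp (2 * Real.pi * Complex.I / 24) = ζ at *
  rw [etaQuotSharp, h4, h2, ← hI, etaQuotSharp]
  norm_cast
  field_simp

theorem etaQuotFlat_T_zpow_four_smul (τ : ℍ) : etaQuotFlat (T ^ (4 : ℤ) • τ) = etaQuotFlat τ := by
  have h4 := etaScaled_T_zpow_smul (r := 1 / 4) (n := 4) (m := 1) (by norm_num) τ
  have h2 := etaScaled_T_zpow_smul (r := 1 / 2) (n := 4) (m := 2) (by norm_num) τ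
  have h0 := Complex.exp_ne_zero (2 * Real.pi * Complex.I / 24)
  have h1 := etaScaled_ne_zero (r := 1 / 2) (by norm_num) τ
  rw [etaQuotFlat, h4, h2, etaQuotFlat, zpow_one]
  norm_cast
  field_simp

/-- Translation by 2 shifts τ/4 by 1/2, where `eta_add_half` applies. The formula is needed at the
cusp T²S of `flatRatio`. -/
theorem etaQuotFlat_T_zpow_two_smul : ∃ C : ℂ, C ≠ 0 ∧ ∀ τ, etaQuotFlat (T ^ (2 : ℤ) • τ) =
    C * (etaScaled (1 / 2) τ ^ 5 / (etaScaled (1 / 4) τ ^ 2 * etaScaled 1 τ ^ 2)) := by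
  obtain ⟨C, hC, H⟩ := eta_add_half
  have h0 := Complex.exp_ne_zero (2 * Real.pi * Complex.I / 24)
  refine ⟨C ^ 2 / Complex.exp (2 * Real.pi * Complex.I / 24), by positivity, fun τ => ?_⟩
  have h2 := etaScaled_T_zpow_smul (r := 1 / 2) (n := 2) (m := 1) (by norm_num) τ
  have h4 : etaScaled (1 / 4) (T ^ (2 : ℤ) • τ) =
      C * (etaScaled (1 / 2) τ ^ 3 / (etaScaled (1 / 4) τ * etaScaled 1 τ)) := by
    have h := H (((1 / 4 : ℝ) : ℂ) * τ) (by simpa using τ.im_pos)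
    simp only [etaScaled]
    rw [modular_T_zpow_smul, coe_vadd]
    convert h using 2
    · push_cast; ring
    · congr 3
      · push_cast; ring
      · push_cast; ring
  have h1 := etaScaled_ne_zero (r := 1 / 2) (by norm_num) τ
  have h1' := etaScaled_ne_zero (r := 1 / 4) (by norm_num) τ
  have h1'' := etaScaled_ne_zero one_pos τ
  rw [etaQuotFlat, h4, h2, zpow_one]
  field_simp

/-! ### The eta quotients of weight `1/2` as theta functions -/

theorem isTheta_etaQuotSharp : etaQuotSharp =Θ[atImInfty] cuspDecay := by
  have h := ((isTheta_etaScaled four_pos).pow 2).div (isTheta_etaScaled two_pos)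
  refine h.trans_eventuallyEq (Eventually.of_forall fun τ => ?_)
  have h0 := Real.exp_ne_zero (-2 * Real.pi * τ.im / 24)
  simp only [Real.rpow_ofNat]
  rw [cuspDecay, show -2 * Real.pi * τ.im / 4 = (6 : ℕ) * (-2 * Real.pi * τ.im / 24) by
    push_cast; ring, Real.exp_nat_mul]
  field_simp

theorem isTheta_etaQuotFlat : etaQuotFlat =Θ[atImInfty] (1 : ℍ → ℝ) := by
  have h := ((isTheta_etaScaled (r := 1 / 4) (by norm_num)).pow 2).div
    (isTheta_etaScaled (r := 1 / 2) (by norm_num))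
  refine h.trans_eventuallyEq (Eventually.of_forall fun τ => ?_)
  have h0 := Real.exp_pos (-2 * Real.pi * τ.im / 24)
  simp only [Pi.one_apply]
  rw [← Real.rpow_natCast, ← Real.rpow_mul h0.le, ← Real.rpow_sub h0]
  norm_num

/-- The exponents balance: 5·2 = 2·4 + 2·1. Only the order of growth is needed here, not the product
formula for θ. -/
theorem isTheta_etaQuot_thetaEven : (fun τ => etaScaled 2 τ ^ 5 /
    (etaScaled 4 τ ^ 2 * etaScaled 1 τ ^ 2) / thetaEven τ) =Θ[atImInfty] (1 : ℍ → ℝ) := by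
  have h := (((isTheta_etaScaled two_pos).pow 5).div (((isTheta_etaScaled four_pos).pow 2).mul
    ((isTheta_etaScaled one_pos).pow 2))).div (isTheta_one_of_tendsto one_ne_zero tendsto_thetaEven)
  refine h.trans_eventuallyEq (Eventually.of_forall fun τ => ?_)
  have h0 := Real.exp_ne_zero (-2 * Real.pi * τ.im / 24)
  simp only [Real.rpow_ofNat, Real.rpow_one, Pi.one_apply]
  field_simp

theorem lowerFour_eq : lowerFour = S * T ^ (-4 : ℤ) * S⁻¹ := by
  ext i j
  fin_cases i <;> fin_cases j <;> rfl

theorem thetaEven_sub_thetaOdd_ne_zero (τ : ℍ) : thetaEven τ - thetaOdd τ ≠ 0 := by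
  simpa using thetaEven_sub_mul_ne_zero (one_pow 4) τ

theorem thetaEven_add_thetaOdd_ne_zero (τ : ℍ) : thetaEven τ + thetaOdd τ ≠ 0 := by
  simpa using thetaEven_sub_mul_ne_zero (a := -1) (by norm_num) τ

theorem tendsto_thetaEven_sub_thetaOdd :
    Tendsto (fun τ => thetaEven τ - thetaOdd τ) atImInfty (𝓝 1) := by
  simpa using tendsto_thetaEven.sub tendsto_thetaOdd

/-- The quotient of `η^♯(2τ)` by `θ(τ/4) - θ(τ)`. -/
noncomputable def sharpRatio (τ : ℍ) : ℂ := etaQuotSharp τ / thetaOdd τ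

/-- The quotient of `η^♭(τ/2)` by `2θ(τ) - θ(τ/4)`. -/
noncomputable def flatRatio (τ : ℍ) : ℂ := etaQuotFlat τ / (thetaEven τ - thetaOdd τ)

theorem sharpRatio_T_smul (τ : ℍ) : sharpRatio (T • τ) = sharpRatio τ := by
  rw [sharpRatio, etaQuotSharp_T_smul, thetaOdd_T_smul, mul_div_mul_left _ _ Complex.I_ne_zero,
    sharpRatio]

theorem sharpRatio_T_zpow_smul (i : ℤ) (τ : ℍ) : sharpRatio (T ^ i • τ) = sharpRatio τ := by
  induction i generalizing τ with
  | zero => simp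
  | succ n ih => rw [zpow_add, mul_smul, ih, zpow_one, sharpRatio_T_smul]
  | pred n ih =>
    rw [← sharpRatio_T_smul, ← mul_smul, ← zpow_one_add, add_sub_cancel, ih]

theorem sharpRatio_S_smul : ∃ C : ℂ, C ≠ 0 ∧ ∀ τ, sharpRatio (S • τ) = C * flatRatio τ := by
  obtain ⟨C, hC, h⟩ := etaQuotSharp_S_smul
  have h1 := one_sub_I_div_two_ne_zero
  refine ⟨C / ((1 - Complex.I) / 2), div_ne_zero hC h1, fun τ => ?_⟩
  have h2 := sqrt_ne_zero τ.ne_zero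
  have h3 := thetaEven_sub_thetaOdd_ne_zero τ
  rw [sharpRatio, h, thetaOdd_S_smul, flatRatio]
  generalize (1 - Complex.I) / 2 = κ at *
  field_simp

theorem flatRatio_T_zpow_four_smul (τ : ℍ) : flatRatio (T ^ (4 : ℤ) • τ) = flatRatio τ := by
  rw [flatRatio, etaQuotFlat_T_zpow_four_smul,
    thetaSpace_T_zpow_four_smul thetaEven_mem_thetaSpace,
    thetaSpace_T_zpow_four_smul thetaOdd_mem_thetaSpace, flatRatio]

theorem sharpRatio_lowerFour_smul (τ : ℍ) : sharpRatio (lowerFour • τ) = sharpRatio τ := by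
  obtain ⟨C, hC, h⟩ := sharpRatio_S_smul
  have h1 : flatRatio (T ^ (-4 : ℤ) • S⁻¹ • τ) = flatRatio (S⁻¹ • τ) := by
    rw [← flatRatio_T_zpow_four_smul, ← mul_smul, ← zpow_add, add_neg_cancel, zpow_zero, one_smul]
  rw [lowerFour_eq, mul_smul, mul_smul, h, h1, ← h, ← mul_smul, mul_inv_cancel, one_smul]

/-- T multiplies numerator and denominator by i, and (1 0; 4 1) = S T⁻⁴ S⁻¹ acts through the
4-periodicity of `flatRatio`; these two matrices generate Γ₁(4). -/
theorem sharpRatio_smul {γ : SL(2, ℤ)} (hγ : γ ∈ Gamma 4) (τ : ℍ) :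
    sharpRatio (γ • τ) = sharpRatio τ := by
  obtain ⟨-, hc, hd⟩ := gamma_four_entries hγ
  refine gammaOneFour_induction (p := fun γ => ∀ τ : ℍ, sharpRatio (γ • τ) = sharpRatio τ)
    (fun τ => by rw [one_smul]) (fun δ _ _ => ?_) (fun δ _ _ => ?_) γ hc hd τ
  · refine ⟨fun h τ => ?_, fun h τ => by rw [mul_smul, h, sharpRatio_T_smul]⟩
    rw [← inv_smul_smul T⁻¹ τ, inv_inv, ← mul_smul, h, sharpRatio_T_smul]
  · refine ⟨fun h τ => ?_, fun h τ => by rw [mul_smul, h, sharpRatio_lowerFour_smul]⟩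
    rw [← inv_smul_smul lowerFour⁻¹ τ, inv_inv, ← mul_smul, h, sharpRatio_lowerFour_smul]

theorem flatRatio_T_zpow_two_smul_S_smul : ∃ C : ℂ, ∀ τ : ℍ, flatRatio (T ^ (2 : ℤ) • S • τ) =
    C * (etaScaled 2 τ ^ 5 / (etaScaled 4 τ ^ 2 * etaScaled 1 τ ^ 2) / thetaEven τ) := by
  obtain ⟨C, -, h⟩ := etaQuotFlat_T_zpow_two_smul
  obtain ⟨C₂, -, h₂⟩ := etaScaled_S_smul (r := 1 / 2) (s := 2) (by norm_num) (by norm_num)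
  obtain ⟨C₄, hC₄, h₄⟩ := etaScaled_S_smul (r := 1 / 4) (s := 4) (by norm_num) (by norm_num)
  obtain ⟨C₁, hC₁, h₁⟩ := etaScaled_S_smul (r := 1) (s := 1) (by norm_num) (by norm_num)
  have hI : Complex.I ^ (2 : ℤ) = -1 := Complex.I_sq
  have hκ := one_sub_I_div_two_ne_zero
  refine ⟨C * C₂ ^ 5 / (C₄ ^ 2 * C₁ ^ 2 * (2 * ((1 - Complex.I) / 2))), fun τ => ?_⟩
  have e : thetaEven (S • τ) - -1 * thetaOdd (S • τ) =
      2 * ((1 - Complex.I) / 2) * (τ : ℂ) ^ (1 / 2 : ℂ) * thetaEven τ := by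
    rw [thetaEven_S_smul, thetaOdd_S_smul]; ring
  have hs := sqrt_ne_zero τ.ne_zero
  rw [flatRatio, h, thetaEven_T_zpow_smul, thetaOdd_T_zpow_smul, hI, e, h₂, h₄, h₁]
  generalize (τ : ℂ) ^ (1 / 2 : ℂ) = s at *
  generalize (1 - Complex.I) / 2 = κ at *
  field_simp

theorem isBoundedAtImInfty_sharpRatio_smul (α : SL(2, ℤ)) :
    IsBoundedAtImInfty fun τ => sharpRatio (α • τ) := by
  obtain ⟨γ, hγ, β, hα, i, hβ⟩ := exists_cusp_representative α
  obtain ⟨C, -, hC⟩ := sharpRatio_S_smul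
  have h1 : (fun τ => sharpRatio (α • τ)) = fun τ => sharpRatio (β • τ) := by
    ext τ
    rcases hα with rfl | rfl
    · rw [mul_smul, sharpRatio_smul hγ]
    · rw [ModularGroup.SL_neg_smul, mul_smul, sharpRatio_smul hγ]
  rw [h1]
  -- At i∞ numerator and denominator both have size e^{-πy/2}. The other two types of cusp lead to
  -- `flatRatio` at i∞ and after T²S, both bounded.
  rcases hβ with rfl | ⟨j, rfl⟩ | rfl
  · simp only [sharpRatio_T_zpow_smul]
    have h2 := (isTheta_etaQuotSharp.div isTheta_thetaOdd).isBigO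
    refine h2.trans (IsBigO.of_bound 1 (Eventually.of_forall fun τ => ?_))
    have h3 : cuspDecay τ ≠ 0 := Real.exp_ne_zero _
    simp [h3]
  · simp only [mul_smul, sharpRatio_T_zpow_smul, hC]
    have h2 := (isTheta_etaQuotFlat.div
      (isTheta_one_of_tendsto one_ne_zero tendsto_thetaEven_sub_thetaOdd)).isBigO
    have h3 : flatRatio =O[atImInfty] (1 : ℍ → ℝ) := by
      simp only [Pi.one_apply, div_one] at h2
      exact h2
    exact (h3.comp_tendsto (tendsto_T_zpow_smul j)).const_mul_left C
  · obtain ⟨D, hD⟩ := flatRatio_T_zpow_two_smul_S_smul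
    simp only [mul_smul, sharpRatio_T_zpow_smul, hC, hD]
    exact (isTheta_etaQuot_thetaEven.isBigO.const_mul_left D).const_mul_left C

theorem mdifferentiable_sharpRatio : MDifferentiable 𝓘(ℂ) 𝓘(ℂ) sharpRatio :=
  (((mdifferentiable_etaScaled four_pos).pow 2).div (mdifferentiable_etaScaled two_pos)
    (etaScaled_ne_zero two_pos)).div mdifferentiable_thetaOdd thetaOdd_ne_zero

/-- `sharpRatio` is constant as a bounded invariant function of weight 0; S carries this to
`flatRatio`. The constants are nonzero because eta quotients have no zeros. -/
theorem exists_etaQuot_eq : ∃ c d : ℂ, c ≠ 0 ∧ d ≠ 0 ∧ etaQuotFlat = c • (thetaEven - thetaOdd) ∧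
    etaQuotSharp = d • thetaOdd := by
  obtain ⟨d, hd⟩ := eq_const_of_gamma_four mdifferentiable_sharpRatio
    (fun γ hγ τ => sharpRatio_smul hγ τ) isBoundedAtImInfty_sharpRatio_smul
  obtain ⟨C, hC, h⟩ := sharpRatio_S_smul
  have h1 : etaQuotSharp = d • thetaOdd := by
    ext τ
    exact (div_eq_iff (thetaOdd_ne_zero τ)).mp (hd τ)
  have h2 : etaQuotFlat = (d / C) • (thetaEven - thetaOdd) := by
    ext τ
    refine (div_eq_iff (thetaEven_sub_thetaOdd_ne_zero τ)).mp ?_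
    rw [eq_div_iff hC, mul_comm, ← hd (S • τ), h, flatRatio]
  have h0 : d ≠ 0 := by
    rintro rfl
    exact etaQuotSharp_ne_zero UpperHalfPlane.I (by rw [h1, zero_smul, Pi.zero_apply])
  exact ⟨d / C, d, div_ne_zero h0 hC, h0, h2, h1⟩

/-- Any two forms in the span of which both theta functions lie generate the ring. -/
theorem adjoin_form_pair_eq_top {p q : ℍ → ℂ} (hp : p ∈ modForms (Gamma 4) 1)
    (hq : q ∈ modForms (Gamma 4) 1) {a b c d : ℂ} (he : thetaEven = a • p + b • q)
    (ho : thetaOdd = c • p + d • q) :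
    Algebra.adjoin ℂ {ModRing.form hp, ModRing.form hq} =
      (⊤ : Subalgebra ℂ (ModRing (Gamma 4))) := by
  have key : ∀ {f : ℍ → ℂ} (hf : f ∈ modForms (Gamma 4) 1) (x y : ℂ), f = x • p + y • q →
      ModRing.form hf ∈ Algebra.adjoin ℂ {ModRing.form hp, ModRing.form hq} := by
    intro f hf x y hxy
    have h : ModRing.form hf = x • ModRing.form hp + y • ModRing.form hq := by
      rw [smul_form, smul_form, form_add]
      exact form_congr _ _ rfl hxy
    rw [h]
    exact add_mem (Subalgebra.smul_mem _ (Algebra.subset_adjoin (by simp)) x)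
      (Subalgebra.smul_mem _ (Algebra.subset_adjoin (by simp)) y)
  rw [eq_top_iff, ← adjoin_theta_eq_top]
  refine Algebra.adjoin_le ?_
  rintro f (rfl | rfl)
  · exact key _ a b he
  · exact key _ c d ho

/-! ### The two generating pairs. -/

theorem theta_pair {p : ℍ → ℂ} (hp : p ∈ modForms (Gamma 4) 1) (h : p = thetaEven + thetaOdd) :
    AlgebraicIndependent ℂ ![ModRing.form hp, ModRing.form thetaEven_mem_modForms] ∧
      Algebra.adjoin ℂ {ModRing.form hp, ModRing.form thetaEven_mem_modForms} =
        (⊤ : Subalgebra ℂ (ModRing (Gamma 4))) := by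
  subst h
  constructor
  · refine algebraicIndependent_form_pair hp _ thetaEven_add_thetaOdd_ne_zero (l := 1) ?_ ?_
    · have := tendsto_thetaEven.div (tendsto_thetaEven.add tendsto_thetaOdd) (by simp)
      rwa [add_zero, div_one] at this
    · refine ⟨UpperHalfPlane.I, fun h => thetaOdd_ne_zero UpperHalfPlane.I ?_⟩
      rw [Pi.add_apply, div_eq_one_iff_eq (thetaEven_add_thetaOdd_ne_zero _)] at h
      linear_combination -h
  · exact adjoin_form_pair_eq_top hp _ (a := 0) (b := 1) (c := 1) (d := -1) (by simp) (by simp)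

theorem eta_pair {p q : ℍ → ℂ} (hp : p ∈ modForms (Gamma 4) 1) (hq : q ∈ modForms (Gamma 4) 1)
    (hpe : p = etaQuotFlat) (hqe : q = etaQuotSharp) :
    AlgebraicIndependent ℂ ![ModRing.form hp, ModRing.form hq] ∧
      Algebra.adjoin ℂ {ModRing.form hp, ModRing.form hq} =
        (⊤ : Subalgebra ℂ (ModRing (Gamma 4))) := by
  subst hpe hqe
  obtain ⟨c, d, hc, hd, h1, h2⟩ := exists_etaQuot_eq
  constructor
  · refine algebraicIndependent_form_pair hp hq etaQuotFlat_ne_zero (l := 0) ?_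
      ⟨UpperHalfPlane.I, div_ne_zero (etaQuotSharp_ne_zero _) (etaQuotFlat_ne_zero _)⟩
    rw [h1, h2]
    have := (tendsto_thetaOdd.const_mul d).div (tendsto_thetaEven_sub_thetaOdd.const_mul c)
      (by simpa using hc)
    rwa [mul_zero, zero_div] at this
  · refine adjoin_form_pair_eq_top hp hq (a := c⁻¹) (b := d⁻¹) (c := 0) (d := d⁻¹) ?_ ?_
    · rw [h1, h2, inv_smul_smul₀ hc, inv_smul_smul₀ hd, sub_add_cancel]
    · rw [h2, inv_smul_smul₀ hd, zero_smul, zero_add]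

theorem etaFlat_div_two (τ : ℍ) : etaFlat ((τ : ℂ) / 2) = etaQuotFlat τ := by
  rw [etaFlat, etaQuotFlat, etaScaled, etaScaled]
  congr 3
  · push_cast; ring
  · push_cast; ring

theorem etaSharp_two_mul (τ : ℍ) : etaSharp (2 * (τ : ℂ)) = etaQuotSharp τ := by
  rw [etaSharp, etaQuotSharp, etaScaled, etaScaled]
  congr 3
  push_cast; ring

theorem etaQuotFlat_mem_modForms : etaQuotFlat ∈ modForms (Gamma 4) 1 := by
  obtain ⟨c, d, -, -, h, -⟩ := exists_etaQuot_eq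
  rw [h]
  exact Submodule.smul_mem _ _ (Submodule.sub_mem _ thetaEven_mem_modForms thetaOdd_mem_modForms)

theorem etaQuotSharp_mem_modForms : etaQuotSharp ∈ modForms (Gamma 4) 1 := by
  obtain ⟨c, d, -, -, -, h⟩ := exists_etaQuot_eq
  rw [h]
  exact Submodule.smul_mem _ _ thetaOdd_mem_modForms

end HalfIntegralWeight

theorem mainTheorem3 :
    -- `θ(τ/4)`, `θ(τ)`, `η^♭(τ/2)` and `η^♯(2τ)` are forms of weight `1/2` for `Γ(4)`
    ∃ (h₁ : (fun τ : ℍ => theta ((τ : ℂ) / 4)) ∈ modForms (Gamma 4) 1)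
      (h₂ : (fun τ : ℍ => theta (τ : ℂ)) ∈ modForms (Gamma 4) 1)
      (h₃ : (fun τ : ℍ => etaFlat ((τ : ℂ) / 2)) ∈ modForms (Gamma 4) 1)
      (h₄ : (fun τ : ℍ => etaSharp (2 * (τ : ℂ))) ∈ modForms (Gamma 4) 1)
      -- and `η^6` is a form of weight `3`
      (h₅ : (fun τ : ℍ => ModularForm.eta (τ : ℂ) ^ 6) ∈ modForms (Gamma 4) 6),
      -- the graded ring is the polynomial ring `ℂ[θ(τ/4), θ]`
      (AlgebraicIndependent ℂ ![ModRing.form h₁, ModRing.form h₂] ∧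
        Algebra.adjoin ℂ {ModRing.form h₁, ModRing.form h₂} = (⊤ : Subalgebra ℂ (ModRing (Gamma 4)))) ∧
      -- and the polynomial ring `ℂ[η^♭(τ/2), η^♯(2τ)]`
      (AlgebraicIndependent ℂ ![ModRing.form h₃, ModRing.form h₄] ∧
        Algebra.adjoin ℂ {ModRing.form h₃, ModRing.form h₄} = (⊤ : Subalgebra ℂ (ModRing (Gamma 4)))) ∧
      -- the ideal of cusp forms is the principal ideal generated by `η^6`
      cuspIdeal (Gamma 4) = Ideal.span {ModRing.form h₅} := by
  have e₁ : (fun τ : ℍ => theta ((τ : ℂ) / 4)) = thetaEven + thetaOdd := by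
    ext τ
    simp [thetaEven, thetaOdd]
  have e₃ : (fun τ : ℍ => etaFlat ((τ : ℂ) / 2)) = etaQuotFlat := funext etaFlat_div_two
  have e₄ : (fun τ : ℍ => etaSharp (2 * (τ : ℂ))) = etaQuotSharp := funext etaSharp_two_mul
  have h₁ := Submodule.add_mem _ thetaEven_mem_modForms thetaOdd_mem_modForms
  rw [← e₁] at h₁
  have h₃ := etaQuotFlat_mem_modForms
  rw [← e₃] at h₃
  have h₄ := etaQuotSharp_mem_modForms
  rw [← e₄] at h₄
  exact ⟨h₁, thetaEven_mem_modForms, h₃, h₄, etaSix_mem_modForms, theta_pair h₁ e₁,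
    eta_pair h₃ h₄ e₃ e₄, cuspIdeal_eq_span⟩
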